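/- **Setting.** $[n]=\{0,\dots,n-1\}$, $\oplus$ is bit-wise exclusive-or and $\lg=\log_2$. The universe is $U=[u]$ and the range is $R=[2^b]$, identified with the $b$-bit strings. A random function $H:U\to R$ is *$k$-independent* if for any distinct $x_1,\dots,x_k\in U$ the values $H(x_1),\dots,H(x_k)$ are independent, and $H(x)$ is uniform in $R$ for every $x\in U$. *Simple tabulation* with character tables $h_0,\dots,h_{n-1}:\Phi\to\Psi^d$ is the map $\Phi^n\to\Psi^d$, $x\mapsto\bigoplus_{i\in[n]}h_i(x_i)$, where $\Phi,\Psi$ are sets of bit strings. **Recursive tabulation** with parameter $c$. Let $\ell=\lceil\lg c\rceil+1$, $c'=2^\ell$, $s=\lceil(\lg u)/c'\rceil$ and let $\Phi$ be the set of $s$-bit strings. For $0\le m\le\ell$ let $U_m=\Phi^{2^m}$, the set of bit strings of length $2^ms$; $U=[u]$ is regarded as a subset of $U_\ell$ by binary representation. The *universal part* consists of one simple tabulation function $h_{(m)}:U_m=\Phi^{2^m}\to U_{m-1}^{\,12\cdot 2^m}$ for each $m=1,\dots,\ell$. A recursive hash function $U_0=\Phi\to R$ is a table. For $m\geq 1$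 a recursive hash function on $U_m$ is $x\mapsto\bigoplus_{j}g_j(h_{(m)}(x)_j)$, with $j$ ranging over the $12\cdot 2^m$ output positions and each $g_j$ a recursive hash function on $U_{m-1}$; all $g_j$ use the same $h_{(m-1)},\dots,h_{(1)}$, but each has bottom tables of its own. Thus a hash function $U\to R$ is given by the universal part and $D=\prod_{m=1}^{\ell}12\cdot2^m$ bottom tables $\Phi\to R$. All entries of the tables of the universal part and of the bottom tables are independent and uniformly random. **Model.** Word RAM with word length $w$, where $u\le 2^w$ and $b\le w$ (each key and each hash value fits in a word), and the usual unit-cost operations on words. A representation of the hash function is stored in memory in advance; its preprocessing is not charged. The query program, which is one fixed program for all parameters, computes the hash value of a given key and leaves the representation intact. Space is the number of memory words used, for the representation and by the query; time is the number of steps of a query. **Theorem.** There are an absolute constant $\kappa>0$ and a query program such that the following holds, asymptotically as $c\to\infty$ and $u\to\infty$ with $c^{\,c^2}=u^{o(1)}$, for all $b$ and $w$ as above. With probability $1-o(1/u^{1/c})$ over the choice of the universal part, recursive tabulation with this universal part and random bottom tables is $k$-independent from $U$ to $R$ for every integer $k\le u^{\kappa/c}$ (so it is $u^{\Omega(1/c)}$-independent).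 Moreover, for all choices of the tables, the program evaluates the hash function using space $o(u^{1/c})$ and time $o(c^{\lg c})$. -/

import Mathlib

open Filter Topology Asymptotics MeasureTheory ProbabilityTheory

namespace RecTab

/-! ### Random hash functions -/

/-- Bit strings carry the discrete σ-algebra. -/
instance instMeasurableSpaceBitVec (n : ℕ) : MeasurableSpace (BitVec n) := ⊤

/-- A random function `H ω : K → V` (`ω` distributed according to `μ`) is `k`-independent if
the hash values of any `k` distinct keys are independent random variables, and the hash value
of every fixed key is uniformly distributed in `V`. -/
def KIndependent {Ω K V : Type} [MeasurableSpace Ω] [MeasurableSpace V] [Fintype V]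
    (μ : Measure Ω) (k : ℕ) (H : Ω → K → V) : Prop :=
  (∀ x : Fin k → K, Function.Injective x →
      iIndepFun (fun (i : Fin k) (ω : Ω) => H ω (x i)) μ) ∧
    ∀ (x : K) (v : V), μ {ω | H ω x = v} = ((Fintype.card V : ℕ) : ENNReal)⁻¹

/-! ### Simple tabulation and recursive tabulation -/

/-- The bit-wise exclusive-or `⨁_{i ∈ [n]} f i`. -/
def xorSum {n b : ℕ} (f : Fin n → BitVec b) : BitVec b :=
  (Finset.univ : Finset (Fin n)).fold (fun x y => x ^^^ y) 0 f

/-- Character `i` of a key that consists of `n` characters of `s` bits each. -/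
def charAt {n s : ℕ} (x : BitVec (n * s)) (i : Fin n) : BitVec s :=
  x.extractLsb' (i * s) s

/-- The character tables of a simple tabulation function `Φ^n → Ψ^d`, where `Φ` is the set of
`s`-bit strings and `Ψ` the set of `t`-bit strings. -/
abbrev Tables (n s d t : ℕ) : Type := Fin n → BitVec s → Fin d → BitVec t

/-- Simple tabulation: output character `j` is the xor over `i ∈ [n]` of the `j`-th output
character stored in table `i` for the input character `x_i`. -/
def simpleTab {n s d t : ℕ} (h : Tables n s d t) (x : BitVec (n * s)) : Fin d → BitVec t :=
  fun j => xorSum fun i => h i (charAt x i) j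

/-- Levels are numbered from the bottom. On level `m + 1` a key has `2 ^ (m + 1)` characters of
`s` bits. The simple tabulation function of this level maps it to `12 * 2 ^ (m + 1)` output
characters, each of which is a key of level `m`, that is, has half as many bits. -/
abbrev LevelTables (s m : ℕ) : Type :=
  Tables (2 ^ (m + 1)) s (12 * 2 ^ (m + 1)) (2 ^ m * s)

/-- The universal tables of a recursion of depth `ℓ`: one simple tabulation function for each
level. -/
abbrev UniversalTables (s ℓ : ℕ) : Type := (m : Fin ℓ) → LevelTables s m

/-- The positions of the output characters on the bottom of a recursion of depth `ℓ`;
there are `∏_{1 ≤ m ≤ ℓ} 12 * 2 ^ m` of them. -/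
def Leaf : ℕ → Type
  | 0 => Unit
  | m + 1 => Fin (12 * 2 ^ (m + 1)) × Leaf m

/-- The character tables `Φ → R` on the bottom level, one for each output position;
`R` is the set of `b`-bit strings. -/
abbrev LeafTables (s b ℓ : ℕ) : Type := Leaf ℓ → BitVec s → BitVec b

/-- Recursive tabulation: apply the universal simple tabulation function of the current level,
hash each output character `j` recursively (with the same universal functions on the lower
levels, but with bottom tables of its own), and take the xor of the results. -/
def recHash {s b : ℕ} :
    (ℓ : ℕ) → UniversalTables s ℓ → LeafTables s b ℓ → BitVec (2 ^ ℓ * s) → BitVec b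
  | 0, _, r, x => r () (charAt x ⟨0, Nat.one_pos⟩)
  | m + 1, h, r, x =>
      xorSum fun j => recHash m (fun i => h i.castSucc) (fun p => r (j, p))
        (simpleTab (h (Fin.last m)) x j)

/-- The recursion depth `⌈lg c⌉ + 1`. -/
def depth (c : ℕ) : ℕ := Nat.clog 2 c + 1

/-- The number `⌈lg u / c'⌉` of bits of an input character, where `c' = 2 ^ depth c` is the
number of input characters of a key from `[u]`. -/
def charBits (u c : ℕ) : ℕ := Nat.clog 2 u ⌈/⌉ 2 ^ depth c

/-- The hash function `[u] → [2 ^ b]` given by recursive tabulation with the universal tables `h`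
and the bottom tables `r`. A key is viewed as a string of `c' * charBits u c ≥ lg u` bits. -/
def tabHash {u c b : ℕ} (h : UniversalTables (charBits u c) (depth c))
    (r : LeafTables (charBits u c) b (depth c)) (x : Fin u) : BitVec b :=
  recHash (depth c) h r (BitVec.ofNat (2 ^ depth c * charBits u c) x)

/-- The uniform distribution: all tables are filled with independent random characters. -/
noncomputable def unif (Ω : Type) [MeasurableSpace Ω] : Measure Ω := uniformOn Set.univ

/-- For these universal tables, the family of hash functions given by random bottom tables is
`k`-independent. -/
def Good {u c : ℕ} (b k : ℕ) (h : UniversalTables (charBits u c) (depth c)) : Prop :=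
  KIndependent (unif (LeafTables (charBits u c) b (depth c))) k (fun r => tabHash h r)

/-! ### The word RAM

Programs in a fragment of C. The word length `w` is a parameter of the execution, not of the
program. Time is the number of operations executed, and the memory has `S` cells, each holding
a word; an access to any other cell is an error. -/

/-- The binary operations on words (unsigned arithmetic modulo `2 ^ w`). -/
inductive Op
  | add | sub | mul | div | mod | and | or | xor | shl | shr | lt | eq

def Op.eval {w : ℕ} : Op → BitVec w → BitVec w → BitVec w
  | .add, a, b => a + b
  | .sub, a, b => a - b
  | .mul, a, b => a * b
  | .div, a, b => a / b
  | .mod, a, b => a % b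
  | .and, a, b => a &&& b
  | .or, a, b => a ||| b
  | .xor, a, b => a ^^^ b
  | .shl, a, b => a <<< b
  | .shr, a, b => a >>> b
  | .lt, a, b => if a < b then 1 else 0
  | .eq, a, b => if a = b then 1 else 0

/-- Expressions: numerals, registers (local variables), memory reads, binary operations. -/
inductive Expr
  | lit (n : ℕ)
  | reg (i : ℕ)
  | load (addr : Expr)
  | bin (o : Op) (e₁ e₂ : Expr)

/-- Commands. -/
inductive Cmd
  | skip
  | assign (i : ℕ) (e : Expr)
  | store (addr e : Expr)
  | seq (p q : Cmd)
  | cond (e : Expr) (p q : Cmd)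
  | loop (e : Expr) (p : Cmd)

/-- The state of a machine with word length `w`. -/
structure State (w : ℕ) where
  reg : ℕ → BitVec w
  mem : ℕ → BitVec w

/-- The number of operations needed to evaluate an expression. -/
def Expr.cost : Expr → ℕ
  | .lit _ => 1
  | .reg _ => 1
  | .load e => e.cost + 1
  | .bin _ e₁ e₂ => e₁.cost + e₂.cost + 1

/-- The value of an expression; `none` if it reads outside the `S` memory cells. -/
def Expr.eval {w : ℕ} (S : ℕ) (σ : State w) : Expr → Option (BitVec w)
  | .lit n => some (BitVec.ofNat w n)
  | .reg i => some (σ.reg i)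
  | .load e => (e.eval S σ).bind fun a => if a.toNat < S then some (σ.mem a.toNat) else none
  | .bin o e₁ e₂ => (e₁.eval S σ).bind fun a => (e₂.eval S σ).bind fun b => some (o.eval a b)

/-- `Exec S p σ t σ'`: on a machine with `S` memory cells, the program `p` started in the
state `σ` terminates without error in the state `σ'` after exactly `t` steps. -/
inductive Exec {w : ℕ} (S : ℕ) : Cmd → State w → ℕ → State w → Prop
  | skip (σ : State w) : Exec S .skip σ 1 σ
  | assign {σ : State w} {i : ℕ} {e : Expr} {v : BitVec w} (he : e.eval S σ = some v) :
      Exec S (.assign i e) σ (e.cost + 1) { σ with reg := Function.update σ.reg i v }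
  | store {σ : State w} {addr e : Expr} {a v : BitVec w} (ha : addr.eval S σ = some a)
      (hS : a.toNat < S) (he : e.eval S σ = some v) :
      Exec S (.store addr e) σ (addr.cost + e.cost + 1)
        { σ with mem := Function.update σ.mem a.toNat v }
  | seq {σ σ₁ σ₂ : State w} {p q : Cmd} {t₁ t₂ : ℕ} (hp : Exec S p σ t₁ σ₁)
      (hq : Exec S q σ₁ t₂ σ₂) : Exec S (.seq p q) σ (t₁ + t₂) σ₂
  | cond_true {σ σ₁ : State w} {e : Expr} {p q : Cmd} {v : BitVec w} {t : ℕ}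
      (he : e.eval S σ = some v) (hv : v ≠ 0) (hp : Exec S p σ t σ₁) :
      Exec S (.cond e p q) σ (e.cost + t + 1) σ₁
  | cond_false {σ σ₁ : State w} {e : Expr} {p q : Cmd} {v : BitVec w} {t : ℕ}
      (he : e.eval S σ = some v) (hv : v = 0) (hq : Exec S q σ t σ₁) :
      Exec S (.cond e p q) σ (e.cost + t + 1) σ₁
  | loop_true {σ σ₁ σ₂ : State w} {e : Expr} {p : Cmd} {v : BitVec w} {t₁ t₂ : ℕ}
      (he : e.eval S σ = some v) (hv : v ≠ 0) (hp : Exec S p σ t₁ σ₁)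
      (hl : Exec S (.loop e p) σ₁ t₂ σ₂) :
      Exec S (.loop e p) σ (e.cost + t₁ + t₂ + 1) σ₂
  | loop_false {σ : State w} {e : Expr} {p : Cmd} {v : BitVec w}
      (he : e.eval S σ = some v) (hv : v = 0) :
      Exec S (.loop e p) σ (e.cost + 1) σ

/-- The query program `P` evaluates `f : [u] → [2 ^ b]` on machines with word length `w`, in
space `S` and time `T`: there is a representation of `f`, stored in the first `L ≤ S` memory
cells, such that for every key `x`, given in register `0`, the program terminates within `T`
steps with `f x` in register `0`. It uses no more than `S` memory cells, assumes nothing about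
the initial contents of the other registers and of the other memory cells, and leaves the
representation intact. -/
def Evaluates (P : Cmd) (w S T : ℕ) {u b : ℕ} (f : Fin u → BitVec b) : Prop :=
  ∃ (L : ℕ) (rep : ℕ → BitVec w), L ≤ S ∧
    ∀ (x : Fin u) (σ : State w), σ.reg 0 = BitVec.ofNat w x → (∀ a < L, σ.mem a = rep a) →
      ∃ (t : ℕ) (σ' : State w), Exec S P σ t σ' ∧ t ≤ T ∧
        σ'.reg 0 = (f x).setWidth w ∧ ∀ a < L, σ'.mem a = rep a

end RecTab

open RecTab

/-!
If a simple tabulation function of every level sends, in each set of at most `K` keys, some key to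
an output character that no other key of the set has in that position, then xoring with random
tables for the output characters keeps `k ≤ K` hash values independent: the lonely character
frees its key, and the remaining keys are peeled off in the same way.

Suppose the property fails on a set of keys. Thin the set out until it has a subset of `a` keys
whose input characters are still rich enough, and record for `12` output positions per key which
other key agrees there. These are linear equations in the table entries, at least half of which
can be solved one after the other, each with a fresh entry. So a fixed pattern of `12 * a`
collisions has probability at most `g ^ (-6 * a)`, where `g` is the size of the output alphabet,
while the number of patterns is about `g ^ (2 * a)` as `g` is the square root of the number of
keys. The union bound leaves `o(1 / u ^ (1 / c))`.

The query runs through all `∏ 12 * 2 ^ m` leaves of the recursion; the digits of the number of a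
leaf, in the mixed radix `12 * 2 ^ m`, are the output positions on the path to it.
-/

namespace RecTab

/-! ### Uniform distributions and independence -/

-- A shortcut: finding this by search takes too long inside larger instance problems.
instance instCountableBitVec (n : ℕ) : Countable (BitVec n) :=
  Finite.to_countable

section Uniform

variable {Ω : Type} [MeasurableSpace Ω] [MeasurableSingletonClass Ω]

instance isProbabilityMeasure_unif [Finite Ω] [Nonempty Ω] : IsProbabilityMeasure (unif Ω) :=
  isProbabilityMeasure_uniformOn Set.finite_univ Set.univ_nonempty

theorem unif_apply [Fintype Ω] (A : Set Ω) [Fintype A] :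
    unif Ω A = (Fintype.card A : ENNReal) / Fintype.card Ω := by
  rw [unif, uniformOn_univ, Measure.count_apply A.toFinite.measurableSet,
    Set.encard_eq_coe_toFinset_card, Set.toFinset_card, ENat.toENNReal_coe]

theorem unif_real_apply [Fintype Ω] (A : Set Ω) [Fintype A] :
    (unif Ω).real A = (Fintype.card A : ℝ) / Fintype.card Ω := by
  rw [measureReal_def, unif_apply, ENNReal.toReal_div, ENNReal.toReal_natCast,
    ENNReal.toReal_natCast]

theorem unif_singleton [Fintype Ω] (x : Ω) : unif Ω {x} = (Fintype.card Ω : ENNReal)⁻¹ := by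
  rw [unif_apply, Fintype.card_unique, Nat.cast_one, one_div]

theorem eq_unif_of_singleton_eq [Finite Ω] (μ : Measure Ω) [IsProbabilityMeasure μ]
    (h : ∀ x y, μ {x} = μ {y}) : μ = unif Ω := by
  have := Fintype.ofFinite Ω
  refine Measure.ext_of_singleton fun x => ?_
  have hsum : (Fintype.card Ω : ENNReal) * μ {x} = 1 := by
    rw [← measure_univ (μ := μ), ← Finset.coe_univ, ← sum_measure_singleton,
      Finset.sum_congr rfl fun y _ => h y x, Finset.sum_const, nsmul_eq_mul, Finset.card_univ]
  rw [unif_singleton]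
  exact ENNReal.eq_inv_of_mul_eq_one_left ((mul_comm _ _).trans hsum)

theorem unif_pi {ι : Type} [Fintype ι] {α : ι → Type} [∀ i, MeasurableSpace (α i)]
    [∀ i, MeasurableSingletonClass (α i)] [∀ i, Finite (α i)] [∀ i, Nonempty (α i)] :
    unif (∀ i, α i) = Measure.pi fun i => unif (α i) := by
  classical
  have := fun i => Fintype.ofFinite (α i)
  refine (eq_unif_of_singleton_eq _ fun x y => ?_).symm
  simp only [Measure.pi_singleton, unif_singleton]

theorem unif_map_of_surjective {G H : Type} [AddGroup G] [Finite G] [MeasurableSpace G]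
    [MeasurableSingletonClass G] [AddGroup H] [Finite H] [MeasurableSpace H]
    [MeasurableSingletonClass H] (φ : G →+ H) (hφ : Function.Surjective φ) :
    (unif G).map φ = unif H := by
  classical
  have := Fintype.ofFinite G
  have := Fintype.ofFinite H
  have hmeas : Measurable φ := measurable_of_finite _
  have := Measure.isProbabilityMeasure_map (μ := unif G) hmeas.aemeasurable
  refine eq_unif_of_singleton_eq _ fun x y => ?_
  simp only [Measure.map_apply hmeas (measurableSet_singleton _), unif_apply]
  congr 2
  simpa [Fintype.card_subtype] using
    AddMonoidHom.card_fiber_eq_of_mem_range φ (hφ x) (hφ y)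

theorem kIndependent_of_surjective {G K V : Type} [AddGroup G] [Finite G] [MeasurableSpace G]
    [MeasurableSingletonClass G] [AddGroup V] [Fintype V] [MeasurableSpace V]
    [MeasurableSingletonClass V] {k : ℕ} (φ : G →+ (K → V))
    (hone : ∀ x, Function.Surjective fun g => φ g x)
    (hk : ∀ x : Fin k → K, Function.Injective x → Function.Surjective fun g i => φ g (x i)) :
    KIndependent (unif G) k fun g => φ g := by
  have hmap (x : K) : (unif G).map (fun g => φ g x) = unif V :=
    unif_map_of_surjective ((Pi.evalAddMonoidHom _ x).comp φ) (hone x)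
  refine ⟨fun x hx => ?_, fun x v => ?_⟩
  · rw [iIndepFun_iff_map_fun_eq_pi_map fun i => (measurable_of_finite _).aemeasurable]
    simp only [hmap, ← unif_pi]
    exact unif_map_of_surjective (AddMonoidHom.mk' (fun g i => φ g (x i)) fun g g' => by
      ext i; simp) (hk x hx)
  · rw [← unif_singleton v, ← hmap x,
      Measure.map_apply (measurable_of_finite _) (measurableSet_singleton v)]
    rfl

end Uniform

theorem KIndependent.comp_injective {Ω K L V : Type} [MeasurableSpace Ω] [MeasurableSpace V]
    [Fintype V] {μ : Measure Ω} {k : ℕ} {H : Ω → K → V} (hH : KIndependent μ k H) {e : L → K}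
    (he : Function.Injective e) : KIndependent μ k fun ω x => H ω (e x) :=
  ⟨fun x hx => hH.1 (e ∘ x) (he.comp hx), fun x v => hH.2 (e x) v⟩

/-! ### Bit strings under exclusive-or -/

/-- The group of bit strings of length `b` under exclusive-or. It is a type synonym because the
addition of `BitVec b` is addition modulo `2 ^ b`. -/
def XorVec (b : ℕ) : Type := BitVec b

namespace XorVec

variable {b : ℕ}

instance : Add (XorVec b) := ⟨BitVec.xor⟩

instance : Zero (XorVec b) := ⟨(0#b : BitVec b)⟩

instance : Neg (XorVec b) := ⟨fun x => x⟩

instance : AddCommGroup (XorVec b) where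
  add_assoc := BitVec.xor_assoc
  zero_add _ := BitVec.zero_xor
  add_zero _ := BitVec.xor_zero
  neg_add_cancel _ := BitVec.xor_self
  add_comm := BitVec.xor_comm
  nsmul := nsmulRec
  zsmul := zsmulRec

instance : Fintype (XorVec b) := inferInstanceAs (Fintype (BitVec b))

instance : MeasurableSpace (XorVec b) := inferInstanceAs (MeasurableSpace (BitVec b))

instance : MeasurableSingletonClass (XorVec b) :=
  inferInstanceAs (MeasurableSingletonClass (BitVec b))

end XorVec

theorem xorSum_xor {n b : ℕ} (f g : Fin n → BitVec b) :
    xorSum (fun i => f i ^^^ g i) = xorSum f ^^^ xorSum g :=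
  Finset.sum_add_distrib (M := XorVec b) (f := f) (g := g)

theorem xorSum_eq_single {n b : ℕ} {f : Fin n → BitVec b} (j : Fin n)
    (hf : ∀ i, i ≠ j → f i = 0#b) : xorSum f = f j :=
  Fintype.sum_eq_single (M := XorVec b) j hf

theorem xorSum_succ {n b : ℕ} (f : Fin (n + 1) → BitVec b) :
    xorSum f = xorSum (fun i : Fin n => f i.castSucc) ^^^ f (Fin.last n) :=
  Fin.sum_univ_castSucc (M := XorVec b) f

/-! ### Peeling keys with a unique output character -/

/-- Every nonempty set of at most `k` keys contains a key one of whose output characters, at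
positions from `δ`, is shared with no other key of the set. -/
def UniqueOutputs {K δ Ψ : Type} (k : ℕ) (f : K → δ → Ψ) : Prop :=
  ∀ X : Finset K, X.Nonempty → X.card ≤ k →
    ∃ x ∈ X, ∃ j, ∀ y ∈ X, f y j = f x j → y = x

theorem exists_hom_eq_on_of_peel {G K V : Type} [AddGroup G] [AddGroup V] (φ : G →+ (K → V))
    (X : Finset K)
    (hpeel : ∀ Y ⊆ X, Y.Nonempty →
      ∃ x ∈ Y, ∀ v, ∃ g, φ g x = v ∧ ∀ y ∈ Y, y ≠ x → φ g y = 0)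
    (v : K → V) : ∃ g, ∀ x ∈ X, φ g x = v x := by
  classical
  induction X using Finset.strongInduction with
  | H X ih =>
    obtain rfl | hX := X.eq_empty_or_nonempty
    · exact ⟨0, by simp⟩
    obtain ⟨x, hx, hfree⟩ := hpeel X subset_rfl hX
    obtain ⟨g₀, hg₀⟩ := ih _ (Finset.erase_ssubset hx) fun Y hY =>
      hpeel Y (hY.trans (X.erase_subset x))
    obtain ⟨g₁, hg₁x, hg₁⟩ := hfree (-φ g₀ x + v x)
    refine ⟨g₀ + g₁, fun y hy => ?_⟩
    rw [map_add, Pi.add_apply]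
    by_cases hyx : y = x
    · rw [hyx, hg₁x, add_neg_cancel_left]
    · rw [hg₁ y hy hyx, add_zero, hg₀ y (Finset.mem_erase.mpr ⟨hyx, hy⟩)]

/-! ### Independence of recursive tabulation -/

section Recursion

variable {s b : ℕ}

theorem recHash_xor : ∀ (ℓ : ℕ) (h : UniversalTables s ℓ) (r r' : LeafTables s b ℓ)
    (x : BitVec (2 ^ ℓ * s)),
    recHash ℓ h (fun p y => r p y ^^^ r' p y) x = recHash ℓ h r x ^^^ recHash ℓ h r' x
  | 0, _, _, _, _ => rfl
  | m + 1, h, r, r', x => by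
    simp only [recHash, ← xorSum_xor]
    exact congrArg xorSum (funext fun j =>
      recHash_xor m _ (fun p => r (j, p)) (fun p => r' (j, p)) _)

/-- For fixed universal tables, `recHash` as a homomorphism from the group of bottom tables to
the group of hash functions. -/
def recHashHom (b ℓ : ℕ) (h : UniversalTables s ℓ) :
    (Leaf ℓ → BitVec s → XorVec b) →+ (BitVec (2 ^ ℓ * s) → XorVec b) :=
  AddMonoidHom.mk' (fun r => recHash (b := b) ℓ h r) fun r r' => funext (recHash_xor ℓ h r r')

theorem recHashHom_single {m : ℕ} (h : UniversalTables s (m + 1)) (j : Fin (12 * 2 ^ (m + 1)))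
    (r : Leaf m → BitVec s → XorVec b) (x : BitVec (2 ^ (m + 1) * s)) :
    recHashHom b (m + 1) h (fun p => if p.1 = j then r p.2 else 0) x =
      recHashHom b m (fun i => h i.castSucc) r (simpleTab (h (Fin.last m)) x j) := by
  refine (xorSum_eq_single j fun i hi => ?_).trans ?_
  · simp only [hi, if_false]
    exact congrFun (map_zero (recHashHom b m fun i => h i.castSucc)) _
  · simp only [if_true]
    rfl

theorem charAt_toNat {n : ℕ} (x : BitVec (n * s)) (i : Fin n) :
    (charAt x i).toNat = x.toNat / 2 ^ ((i : ℕ) * s) % 2 ^ s := by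
  simp [charAt, BitVec.extractLsb'_toNat, Nat.shiftRight_eq_div_pow]

theorem charAt_injective {n : ℕ} :
    Function.Injective fun (x : BitVec (n * s)) (i : Fin n) => charAt x i := by
  intro x y hxy
  apply BitVec.eq_of_getLsbD_eq
  intro i hi
  have hs : 0 < s := Nat.pos_of_mul_pos_left (Nat.zero_lt_of_lt hi)
  have hq : i / s < n := Nat.div_lt_of_lt_mul (by rwa [Nat.mul_comm])
  have h := congrArg (fun z : BitVec s => z.getLsbD (i % s)) (congrFun hxy ⟨i / s, hq⟩)
  simp only [charAt, BitVec.getLsbD_extractLsb', Nat.mod_lt _ hs, decide_true, Bool.true_and] at h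
  rwa [Nat.div_add_mod' i s] at h

theorem recHashHom_zero_surjective (h : UniversalTables s 0) :
    Function.Surjective (recHashHom b 0 h) := by
  have hchar : Function.Injective fun x : BitVec (2 ^ 0 * s) => charAt x ⟨0, Nat.one_pos⟩ :=
    fun x y hxy => charAt_injective (funext fun i => by
      rwa [show i = ⟨0, Nat.one_pos⟩ from Fin.ext (Nat.lt_one_iff.mp i.isLt)])
  refine fun v => ⟨fun _ => Function.extend (fun x => charAt x ⟨0, Nat.one_pos⟩) v 0, ?_⟩
  exact funext (hchar.extend_apply v 0)

theorem exists_recHashHom_eq_on {k : ℕ} : ∀ (ℓ : ℕ) (h : UniversalTables s ℓ),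
    (∀ m, UniqueOutputs k (simpleTab (h m))) → ∀ X : Finset (BitVec (2 ^ ℓ * s)), X.card ≤ k →
    ∀ v : BitVec (2 ^ ℓ * s) → XorVec b, ∃ r, ∀ x ∈ X, recHashHom b ℓ h r x = v x
  | 0, h, _, _, _, v => by
    obtain ⟨r, rfl⟩ := recHashHom_zero_surjective h v
    exact ⟨r, fun _ _ => rfl⟩
  | m + 1, h, hU, X, hX, v => by
    classical
    refine exists_hom_eq_on_of_peel _ X (fun Y hY hne => ?_) v
    have hYk := (Finset.card_le_card hY).trans hX
    obtain ⟨x, hx, j, hj⟩ := hU (Fin.last m) Y hne hYk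
    refine ⟨x, hx, fun v => ?_⟩
    let out (y : BitVec (2 ^ (m + 1) * s)) := simpleTab (h (Fin.last m)) y j
    obtain ⟨r, hr⟩ := exists_recHashHom_eq_on m (fun i => h i.castSucc)
      (fun i => hU i.castSucc) (Y.image out) (Finset.card_image_le.trans hYk)
      (Pi.single (out x) v)
    refine ⟨fun p => if p.1 = j then r p.2 else 0, ?_, fun y hy hyx => ?_⟩ <;>
      rw [recHashHom_single, hr _ (Finset.mem_image_of_mem out ‹_›)]
    · exact Pi.single_eq_same _ _
    · exact Pi.single_eq_of_ne (fun h' => hyx (hj y hy h')) _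

instance instFintypeLeaf : (ℓ : ℕ) → Fintype (Leaf ℓ)
  | 0 => inferInstanceAs (Fintype Unit)
  | m + 1 =>
    have := instFintypeLeaf m
    inferInstanceAs (Fintype (Fin (12 * 2 ^ (m + 1)) × Leaf m))

theorem kIndependent_recHash {ℓ k K : ℕ} (hk : k ≤ K) (hK : 1 ≤ K) (h : UniversalTables s ℓ)
    (hU : ∀ m, UniqueOutputs K (simpleTab (h m))) :
    KIndependent (unif (LeafTables s b ℓ)) k fun r => recHash ℓ h r := by
  classical
  refine kIndependent_of_surjective (recHashHom b ℓ h) (fun x v => ?_) fun x hx v => ?_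
  · obtain ⟨r, hr⟩ := exists_recHashHom_eq_on ℓ h hU {x} hK fun _ => v
    exact ⟨r, hr x (Finset.mem_singleton_self x)⟩
  · obtain ⟨r, hr⟩ := exists_recHashHom_eq_on (b := b) ℓ h hU (Finset.univ.image x)
      (Finset.card_image_le.trans (by rwa [Finset.card_univ, Fintype.card_fin]))
      (Function.extend x v 0)
    exact ⟨r, funext fun i => (hr _ (Finset.mem_image_of_mem x (Finset.mem_univ i))).trans
      (hx.extend_apply v 0 i)⟩

end Recursion

theorem le_two_pow_keyBits {u c : ℕ} : u ≤ 2 ^ (2 ^ depth c * charBits u c) :=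
  (Nat.le_pow_clog Nat.one_lt_two u).trans
    (Nat.pow_le_pow_right Nat.two_pos
      (le_smul_ceilDiv (pow_pos Nat.two_pos (depth c))))

theorem good_of_uniqueOutputs {u c b k K : ℕ} (hk : k ≤ K) (hK : 1 ≤ K)
    (h : UniversalTables (charBits u c) (depth c))
    (hU : ∀ m, UniqueOutputs K (simpleTab (h m))) : Good b k h := by
  refine (kIndependent_recHash hk hK h hU).comp_injective fun x y hxy => Fin.ext ?_
  have hlt (x : Fin u) := x.isLt.trans_le (le_two_pow_keyBits (c := c))
  simpa [Nat.mod_eq_of_lt (hlt _)] using congrArg BitVec.toNat hxy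

/-! ### Spread sets of keys -/

section Spread

variable {ι Φ δ Ψ : Type} [DecidableEq Φ]

/-- The characters that occur in position `i` of the keys of `X`. -/
def charSet (X : Finset (ι → Φ)) (i : ι) : Finset Φ :=
  X.image fun x => x i

theorem mem_charSet {X : Finset (ι → Φ)} {x : ι → Φ} (hx : x ∈ X) (i : ι) : x i ∈ charSet X i :=
  Finset.mem_image_of_mem _ hx

variable [Fintype ι]

/-- The positions in which not all keys of `X` have the same character. -/
def varyingPositions (X : Finset (ι → Φ)) : Finset ι :=
  {i | (charSet X i).Nontrivial}

theorem mem_varyingPositions {X : Finset (ι → Φ)} {i : ι} :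
    i ∈ varyingPositions X ↔ ∃ x ∈ X, ∃ y ∈ X, x i ≠ y i := by
  simp [varyingPositions, charSet, Finset.Nontrivial, Set.Nontrivial]

theorem varyingPositions_filter_ssubset {X : Finset (ι → Φ)} {p : ι}
    (hp : p ∈ varyingPositions X) (α : Φ) :
    varyingPositions {x ∈ X | x p = α} ⊂ varyingPositions X := by
  refine Finset.ssubset_iff_subset_ne.mpr ⟨fun i hi => ?_, fun heq => ?_⟩
  · obtain ⟨x, hx, y, hy, hxy⟩ := mem_varyingPositions.mp hi
    exact mem_varyingPositions.mpr
      ⟨x, Finset.mem_of_mem_filter x hx, y, Finset.mem_of_mem_filter y hy, hxy⟩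
  · obtain ⟨x, hx, y, hy, hxy⟩ := mem_varyingPositions.mp (heq ▸ hp)
    exact hxy ((Finset.mem_filter.mp hx).2.trans (Finset.mem_filter.mp hy).2.symm)

theorem exists_mem_varyingPositions_max {X : Finset (ι → Φ)} (hX : (varyingPositions X).Nonempty) :
    ∃ p ∈ varyingPositions X, ∀ i, (charSet X i).card ≤ (charSet X p).card := by
  obtain ⟨q, hq⟩ := hX
  obtain ⟨p, -, hp⟩ := Finset.exists_max_image Finset.univ (fun i => (charSet X i).card)
    ⟨q, Finset.mem_univ q⟩
  refine ⟨p, ?_, fun i => hp i (Finset.mem_univ i)⟩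
  simp only [varyingPositions, Finset.mem_filter_univ, ← Finset.one_lt_card_iff_nontrivial] at hq ⊢
  exact hq.trans_le (hp q (Finset.mem_univ q))

variable [Fintype δ] [DecidableEq Ψ]

/-- The output positions in which the output character of `x` is shared with no other key
of `X`. -/
def uniquePositions (f : (ι → Φ) → δ → Ψ) (X : Finset (ι → Φ)) (x : ι → Φ) :
    Finset δ :=
  {j | ∀ y ∈ X, f y j = f x j → y = x}

/-- `X` is spread over position `p`: no other position has more characters, and for each
character `α` of position `p` some key with this character collides in more than `m` output
positions with keys that have another character in position `p`. -/
def Spread (f : (ι → Φ) → δ → Ψ) (X : Finset (ι → Φ)) (p : ι) (m : ℕ) : Prop :=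
  (∀ i, (charSet X i).card ≤ (charSet X p).card) ∧
    ∀ α ∈ charSet X p, ∃ x ∈ X, x p = α ∧
      m < (Finset.univ.filter fun j => ∃ y ∈ X, y p ≠ α ∧ f y j = f x j).card

variable {f : (ι → Φ) → δ → Ψ} {X : Finset (ι → Φ)}

theorem uniquePositions_eq_univ (hX : varyingPositions X = ∅) {x : ι → Φ} (hx : x ∈ X) :
    uniquePositions f X x = Finset.univ := by
  refine Finset.filter_true_of_mem fun j _ y hy _ => funext fun i => ?_
  by_contra hne
  exact Finset.notMem_empty i (hX ▸ mem_varyingPositions.mpr ⟨y, hy, x, hx, hne⟩)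

theorem spread_of_lt_card_uniquePositions {t m : ℕ} {p : ι}
    (hu : ∀ x ∈ X, (uniquePositions f X x).card ≤ t)
    (hp : ∀ i, (charSet X i).card ≤ (charSet X p).card)
    (hslice : ∀ α ∈ charSet X p, ∃ x ∈ X, x p = α ∧
      t + m < (uniquePositions f {y ∈ X | y p = α} x).card) : Spread f X p m := by
  classical
  refine ⟨hp, fun α hα => ?_⟩
  obtain ⟨x, hx, hxα, hxu⟩ := hslice α hα
  have hut := hu x hx
  have hdiff := Finset.le_card_sdiff (uniquePositions f X x)
    (uniquePositions f {y ∈ X | y p = α} x)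
  refine ⟨x, hx, hxα, (show m < _ by omega).trans_le (hdiff.trans (Finset.card_le_card ?_))⟩
  intro j hj
  simp only [uniquePositions, Finset.mem_sdiff, Finset.mem_filter, Finset.mem_univ, true_and,
    not_forall] at hj ⊢
  obtain ⟨huα, y, hy, hfy, hyx⟩ := hj
  exact ⟨y, hy, fun hyα => hyx (huα y ⟨hy, hyα⟩ hfy), hfy⟩

/-- If `X` is not spread over the position `p` with the most characters, then in some slice
`x p = α` every key has at most `t + m` unique positions, and `p` does not vary there. -/
theorem exists_spread {m : ℕ} (t : ℕ) (hX : X.Nonempty)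
    (hu : ∀ x ∈ X, (uniquePositions f X x).card ≤ t)
    (ht : t + m * (varyingPositions X).card < Fintype.card δ) :
    ∃ Y ⊆ X, ∃ p, Y.Nonempty ∧ Spread f Y p m := by
  induction hV : varyingPositions X using Finset.strongInduction generalizing X t with
  | H V ih =>
  subst hV
  obtain hempty | hne := (varyingPositions X).eq_empty_or_nonempty
  · obtain ⟨x, hx⟩ := hX
    have := hu x hx
    rw [uniquePositions_eq_univ hempty hx, Finset.card_univ] at this
    omega
  obtain ⟨p, hpv, hp⟩ := exists_mem_varyingPositions_max hne
  by_cases hslice : ∀ α ∈ charSet X p, ∃ x ∈ X, x p = α ∧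
      t + m < (uniquePositions f {y ∈ X | y p = α} x).card
  · exact ⟨X, subset_rfl, p, hX, spread_of_lt_card_uniquePositions hu hp hslice⟩
  push Not at hslice
  obtain ⟨α, hα, hle⟩ := hslice
  have hlt := varyingPositions_filter_ssubset hpv α
  obtain ⟨x, hx, hxα⟩ := Finset.mem_image.mp hα
  obtain ⟨Y, hY, hspread⟩ := ih _ hlt (t + m) ⟨x, Finset.mem_filter.mpr ⟨hx, hxα⟩⟩
    (fun y hy => hle y (Finset.mem_filter.mp hy).1 (Finset.mem_filter.mp hy).2)
    (by have := Nat.mul_le_mul_left m (Finset.card_lt_card hlt); rw [Nat.mul_succ] at this; omega)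
    rfl
  exact ⟨Y, hY.trans (Finset.filter_subset _ _), hspread⟩

end Spread

/-! ### Witnesses of collisions -/

/-- Simple tabulation with entries in an arbitrary group, with all character tables collected
in a single table that is indexed by input position, input character and output position. -/
def tabSum {ι Φ δ G : Type} [Fintype ι] [AddCommGroup G] (h : ι × Φ × δ → G) (x : ι → Φ) :
    δ → G :=
  fun j => ∑ i, h (i, x i, j)

/-- A certificate that tables have collisions: an input position `pos`, `a` characters for each
input position, and, for each character `α` of position `pos`, a key `x α` and `q` output
positions `out α r`, in which `x α` is claimed to collide with the keys `y α r`. Keys are given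
by the indices of their characters, so that few witnesses have to be counted. -/
structure Witness (ι Φ δ : Type) (q a : ℕ) where
  pos : ι
  chars : ι → Fin a → Φ
  x : Fin a → ι → Fin a
  out : Fin a → Fin q → δ
  y : Fin a → Fin q → ι → Fin a

namespace Witness

variable {ι Φ δ G : Type} {q a : ℕ}

/-- The key whose characters have the indices `z`. -/
def key (W : Witness ι Φ δ q a) (z : ι → Fin a) : ι → Φ := fun i => W.chars i (z i)

/-- The condition under which at least half of the equations claimed by a witness can be solved
for distinct table entries. -/
structure Valid (W : Witness ι Φ δ q a) : Prop where
  chars_injective : Function.Injective (W.chars W.pos)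
  x_pos : ∀ α, W.x α W.pos = α
  out_injective : ∀ α, Function.Injective (W.out α)
  y_pos : ∀ α r, W.y α r W.pos ≠ α

/-- The collisions claimed by the witness do occur for the tables `h`. -/
def Holds [Fintype ι] [AddCommGroup G] (W : Witness ι Φ δ q a) (h : ι × Φ × δ → G) : Prop :=
  ∀ α r, tabSum h (W.key (W.x α)) (W.out α r) = tabSum h (W.key (W.y α r)) (W.out α r)

theorem Valid.one_lt {m : ℕ} {W : Witness ι Φ δ (m + 1) a} (hW : W.Valid) (α : Fin a) : 1 < a := by
  have : Nontrivial (Fin a) := ⟨_, _, hW.y_pos α 0⟩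
  exact Fin.nontrivial_iff_two_le.mp this

/-- A witness as a tuple of its components. -/
def equivProd (ι Φ δ : Type) (q a : ℕ) : Witness ι Φ δ q a ≃
    ι × (ι → Fin a → Φ) × (Fin a → ι → Fin a) × (Fin a → Fin q → δ) ×
      (Fin a → Fin q → ι → Fin a) where
  toFun W := (W.pos, W.chars, W.x, W.out, W.y)
  invFun p := ⟨p.1, p.2.1, p.2.2.1, p.2.2.2.1, p.2.2.2.2⟩

instance [Finite ι] [Finite Φ] [Finite δ] : Finite (Witness ι Φ δ q a) :=
  Finite.of_equiv _ (equivProd ι Φ δ q a).symm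

theorem natCard_eq [Finite ι] : Nat.card (Witness ι Φ δ q a) =
    Nat.card ι * Nat.card Φ ^ (Nat.card ι * a) * a ^ (Nat.card ι * a) * Nat.card δ ^ (q * a) *
      a ^ (q * Nat.card ι * a) := by
  have := Fintype.ofFinite ι
  simp only [Nat.card_congr (equivProd ι Φ δ q a), Nat.card_prod, Nat.card_fun, Nat.card_fin,
    ← pow_mul]
  ring_nf

end Witness

theorem exists_image_eq {α Φ : Type} [Fintype α] [DecidableEq Φ] {A : Finset Φ}
    (hA : A.Nonempty) (hcard : A.card ≤ Fintype.card α) :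
    ∃ g : α → Φ, Finset.univ.image g = A := by
  obtain ⟨e⟩ := Function.Embedding.nonempty_of_card_le ((Fintype.card_coe A).trans_le hcard)
  have : Nonempty A := hA.to_subtype
  refine ⟨fun i => (Function.invFun e i : A), ?_⟩
  have hsurj := Function.invFun_surjective e.injective
  rw [← Finset.coe_inj, Finset.coe_image, Finset.coe_univ, Set.image_univ]
  exact (hsurj.range_comp Subtype.val).trans Subtype.range_coe

section ExistsWitness

variable {ι Φ δ G : Type} [Fintype ι] [DecidableEq Φ] [Fintype δ] [AddCommGroup G]
  [DecidableEq G] {h : ι × Φ × δ → G} {Y : Finset (ι → Φ)} {p : ι} {m : ℕ}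

theorem Spread.exists_embedding (hY : Spread (tabSum h) Y p m) {α : Φ} (hα : α ∈ charSet Y p) :
    ∃ x ∈ Y, x p = α ∧ ∃ J : Fin (m + 1) ↪ δ,
      ∀ r, ∃ y ∈ Y, y p ≠ α ∧ tabSum h y (J r) = tabSum h x (J r) := by
  obtain ⟨x, hx, hxp, hm⟩ := hY.2 α hα
  obtain ⟨J⟩ := Function.Embedding.nonempty_of_card_le
    (((Fintype.card_fin (m + 1)).trans_le hm).trans_eq (Fintype.card_coe _).symm)
  exact ⟨x, hx, hxp, J.trans (.subtype _), fun r => (Finset.mem_filter.mp (J r).2).2⟩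

theorem Spread.exists_witness (hY : Spread (tabSum h) Y p m) (hne : Y.Nonempty) :
    ∃ W : Witness ι Φ δ (m + 1) (charSet Y p).card, W.Valid ∧ W.Holds h := by
  have hchars (i : ι) : ∃ g : Fin (charSet Y p).card → Φ, Finset.univ.image g = charSet Y i :=
    exists_image_eq (hne.image fun x => x i) ((hY.1 i).trans_eq (Fintype.card_fin _).symm)
  choose g hg using hchars
  have hmem (i : ι) (α) : g i α ∈ charSet Y i :=
    hg i ▸ Finset.mem_image_of_mem (g i) (Finset.mem_univ α)
  have hinj : Function.Injective (g p) := by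
    rw [← Set.injOn_univ, ← Finset.coe_univ, ← Finset.card_image_iff, hg, Finset.card_univ,
      Fintype.card_fin]
  have hidx : ∀ x ∈ Y, ∃ z : ι → Fin (charSet Y p).card, (fun i => g i (z i)) = x := by
    intro x hx
    have hx' (i : ι) : x i ∈ Finset.univ.image (g i) := hg i ▸ mem_charSet hx i
    choose z _ hz using fun i => Finset.mem_image.mp (hx' i)
    exact ⟨z, funext hz⟩
  choose x hxY hxp J hy using fun α => hY.exists_embedding (hmem p α)
  choose y hyY hyp hxy using hy
  choose x' hx' using fun α => hidx (x α) (hxY α)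
  choose y' hy' using fun α r => hidx (y α r) (hyY α r)
  refine ⟨⟨p, g, x', fun α => J α, y'⟩, ⟨hinj, fun α => hinj ?_, fun α => (J α).injective,
    fun α r hα => hyp α r ?_⟩, fun α r => ?_⟩
  · exact (congrFun (hx' α) p).trans (hxp α)
  · exact (congrFun (hy' α r) p).symm.trans (congrArg (g p) hα)
  · have hcollide := (hxy α r).symm
    rwa [← hx' α, ← hy' α r] at hcollide

end ExistsWitness

theorem exists_witness {ι Φ δ G : Type} [Fintype ι] [Fintype δ] [AddCommGroup G] {m K : ℕ}
    {h : ι × Φ × δ → G} (hm : m * Fintype.card ι < Fintype.card δ)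
    (hU : ¬ UniqueOutputs K (tabSum h)) :
    ∃ a ∈ Finset.Icc 2 K, ∃ W : Witness ι Φ δ (m + 1) a, W.Valid ∧ W.Holds h := by
  classical
  simp only [UniqueOutputs, not_forall, not_exists, not_and] at hU
  obtain ⟨X, hne, hcard, hno⟩ := hU
  have hu : ∀ x ∈ X, (uniquePositions (tabSum h) X x).card ≤ 0 := by
    intro x hx
    rw [Nat.le_zero, Finset.card_eq_zero]
    refine Finset.filter_false_of_mem fun j _ hj => ?_
    obtain ⟨y, hy, hxy, hyx⟩ := hno x hx j
    exact hyx (hj y hy hxy)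
  have hvar : m * (varyingPositions X).card ≤ m * Fintype.card ι :=
    Nat.mul_le_mul_left m (Finset.card_le_univ _)
  obtain ⟨Y, hYX, p, hYne, hY⟩ := exists_spread (m := m) 0 hne hu (by omega)
  obtain ⟨W, hW, hWh⟩ := hY.exists_witness hYne
  have hpos : 0 < (charSet Y p).card := Finset.card_pos.mpr (hYne.image _)
  have hle : (charSet Y p).card ≤ K :=
    Finset.card_image_le.trans ((Finset.card_le_card hYX).trans hcard)
  exact ⟨_, Finset.mem_Icc.mpr ⟨hW.one_lt ⟨0, hpos⟩, hle⟩, W, hW, hWh⟩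

/-! ### Counting the tables that satisfy a witness -/

section Triangular

variable {Z I R G : Type} [Finite I] [Preorder R]

/-- The hypothesis `hE` says that the value of a pivot variable `v i` is determined by the
variables that are not pivots and the pivots of larger rank. -/
theorem eq_of_triangular {v : I → Z} {ρ : I → R} {h h' : Z → G}
    (hE : ∀ i, (∀ z, (∀ i', v i' = z → ρ i < ρ i') → h z = h' z) → h (v i) = h' (v i))
    (hoff : ∀ z ∉ Set.range v, h z = h' z) : h = h' := by
  have htrans : IsTrans I fun i i' => ρ i' < ρ i := ⟨fun _ _ _ h₁ h₂ => h₂.trans h₁⟩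
  have hirrefl : Std.Irrefl fun i i' : I => ρ i' < ρ i := ⟨fun _ => lt_irrefl _⟩
  have hwf := Finite.wellFounded_of_trans_of_irrefl fun i i' : I => ρ i' < ρ i
  have hpivot (i : I) : h (v i) = h' (v i) := by
    induction i using hwf.induction with
    | _ i ih =>
    refine hE i fun z hz => ?_
    by_cases hz' : z ∈ Set.range v
    · obtain ⟨i', rfl⟩ := hz'
      exact ih i' (hz i' rfl)
    · exact hoff z hz'
  funext z
  by_cases hz : z ∈ Set.range v
  · obtain ⟨i, rfl⟩ := hz
    exact hpivot i
  · exact hoff z hz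

theorem natCard_mul_pow_le_of_triangular [Finite Z] [Finite G] {v : I → Z}
    (hv : Function.Injective v) (ρ : I → R) (E : Set (Z → G))
    (hE : ∀ h ∈ E, ∀ h' ∈ E, ∀ i,
      (∀ z, (∀ i', v i' = z → ρ i < ρ i') → h z = h' z) → h (v i) = h' (v i)) :
    Nat.card E * Nat.card G ^ Nat.card I ≤ Nat.card (Z → G) := by
  rw [← Nat.card_fun, ← Nat.card_prod]
  refine Nat.card_le_card_of_injective
    (fun p : E × (I → G) => Function.extend v p.2 p.1.1) ?_
  rintro ⟨⟨h, hh⟩, g⟩ ⟨⟨h', hh'⟩, g'⟩ heq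
  have hg : g = g' := funext fun i => by
    simpa only [hv.extend_apply] using congrFun heq (v i)
  have hoff : ∀ z ∉ Set.range v, h z = h' z := fun z hz => by
    simpa only [Function.extend_apply' _ _ _ hz] using congrFun heq z
  obtain rfl := eq_of_triangular (hE h hh h' hh') hoff
  rw [hg]

end Triangular

theorem apply_eq_of_sum_eq_sum {ι M : Type} [Fintype ι] [AddCommGroup M] {f f' : ι → M} (p : ι)
    (hsum : ∑ i, f i = ∑ i, f' i) (hne : ∀ i, i ≠ p → f i = f' i) : f p = f' p := by
  classical
  rw [Fintype.sum_eq_add_sum_compl p f, Fintype.sum_eq_add_sum_compl p f',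
    Finset.sum_congr rfl fun i hi => hne i (by simpa using hi)] at hsum
  exact add_right_cancel hsum

namespace Witness

variable {ι Φ δ G : Type} [Fintype ι] [Finite Φ] [Finite δ] [AddCommGroup G] [Finite G]
  {q a : ℕ} {W : Witness ι Φ δ q a}

theorem Valid.natCard_holds_mul_le_of_rank {R : Type} [Preorder R] (hW : W.Valid) (ρ : Fin a → R) :
    Nat.card {h : ι × Φ × δ → G | W.Holds h} *
        Nat.card G ^ Nat.card {p : Fin a × Fin q | ρ p.1 < ρ (W.y p.1 p.2 W.pos)} ≤
      Nat.card (ι × Φ × δ → G) := by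
  let v (p : {p : Fin a × Fin q | ρ p.1 < ρ (W.y p.1 p.2 W.pos)}) : ι × Φ × δ :=
    (W.pos, W.chars W.pos p.1.1, W.out p.1.1 p.1.2)
  refine natCard_mul_pow_le_of_triangular (v := v) ?_ (fun p => ρ p.1.1) _ ?_
  · rintro ⟨⟨α, r⟩, hp⟩ ⟨⟨α', r'⟩, hp'⟩ heq
    simp only [v, Prod.mk.injEq, true_and] at heq
    obtain rfl := hW.chars_injective heq.1
    obtain rfl := hW.out_injective _ heq.2
    rfl
  · rintro h hh h' hh' ⟨⟨α, r⟩, hp⟩ hagree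
    have hy : tabSum h (W.key (W.y α r)) (W.out α r) =
        tabSum h' (W.key (W.y α r)) (W.out α r) := by
      refine Finset.sum_congr rfl fun i _ => hagree _ ?_
      rintro ⟨⟨α', r'⟩, hp'⟩ heq
      simp only [v, Prod.mk.injEq] at heq
      obtain ⟨rfl, hchar, -⟩ := heq
      obtain rfl := hW.chars_injective hchar
      exact hp
    have hx := apply_eq_of_sum_eq_sum W.pos ((hh α r).trans (hy.trans (hh' α r).symm))
      fun i hi => hagree _ ?_
    · simpa only [key, hW.x_pos] using hx
    · rintro ⟨⟨α', r'⟩, hp'⟩ heq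
      simp only [v, Prod.mk.injEq] at heq
      exact absurd heq.1.symm hi

/-- Every equation is usable either for the increasing or for the decreasing order of the
characters, so half of them are usable for one of the two. -/
theorem Valid.natCard_holds_mul_le (hW : W.Valid) {N : ℕ} (hN : 2 * N ≤ q * a) :
    Nat.card {h : ι × Φ × δ → G | W.Holds h} * Nat.card G ^ N ≤ Nat.card (ι × Φ × δ → G) := by
  have hup := hW.natCard_holds_mul_le_of_rank (G := G) fun α => α
  have hdown := hW.natCard_holds_mul_le_of_rank (G := G) OrderDual.toDual
  simp only [OrderDual.toDual_lt_toDual] at hdown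
  have hsplit : q * a ≤ Nat.card {p : Fin a × Fin q | p.1 < W.y p.1 p.2 W.pos} +
      Nat.card {p : Fin a × Fin q | W.y p.1 p.2 W.pos < p.1} := by
    have hunion : {p : Fin a × Fin q | p.1 < W.y p.1 p.2 W.pos} ∪
        {p | W.y p.1 p.2 W.pos < p.1} = Set.univ :=
      Set.eq_univ_of_forall fun p => (hW.y_pos p.1 p.2).symm.lt_or_gt
    have hle := Set.ncard_union_le {p : Fin a × Fin q | p.1 < W.y p.1 p.2 W.pos}
      {p | W.y p.1 p.2 W.pos < p.1}
    rwa [hunion, Set.ncard_univ, Nat.card_prod, Nat.card_fin, Nat.card_fin, mul_comm] at hle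
  have hG := Nat.card_pos (α := G)
  rcases le_or_gt N (Nat.card {p : Fin a × Fin q | p.1 < W.y p.1 p.2 W.pos}) with hle | hlt
  · exact (Nat.mul_le_mul_left _ (Nat.pow_le_pow_right hG hle)).trans hup
  · exact (Nat.mul_le_mul_left _ (Nat.pow_le_pow_right hG (by omega))).trans hdown

theorem Valid.unif_holds_le [MeasurableSpace G] [MeasurableSingletonClass G] (hW : W.Valid)
    {N : ℕ} (hN : 2 * N ≤ q * a) :
    (unif (ι × Φ × δ → G)).real {h | W.Holds h} ≤ 1 / (Nat.card G : ℝ) ^ N := by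
  classical
  have := Fintype.ofFinite (ι × Φ × δ → G)
  have hcard := hW.natCard_holds_mul_le (G := G) hN
  rw [unif_real_apply, ← Nat.card_eq_fintype_card, ← Nat.card_eq_fintype_card,
    div_le_div_iff₀ (by exact_mod_cast Nat.card_pos) (pow_pos (by exact_mod_cast Nat.card_pos) N),
    one_mul]
  exact_mod_cast hcard

end Witness

/-! ### The probability that a level fails -/

/-- The union bound, over all witnesses with `12` collisions per key, for the probability that
a random simple tabulation function with `n` characters from an alphabet of size `φ` and `d`
output characters from an alphabet of size `g` does not have unique output characters. -/
noncomputable def failureBound (n φ d g K : ℕ) : ℝ :=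
  ∑ a ∈ Finset.Icc 2 K,
    ((n * φ ^ (n * a) * a ^ (n * a) * d ^ (12 * a) * a ^ (12 * n * a) : ℕ) : ℝ) /
      (g : ℝ) ^ (6 * a)

theorem unif_not_uniqueOutputs_tabSum_le {ι Φ δ G : Type} [Fintype ι] [Finite Φ] [Fintype δ]
    [AddCommGroup G] [Finite G] [MeasurableSpace G] [MeasurableSingletonClass G] (K : ℕ)
    (hd : 11 * Fintype.card ι < Fintype.card δ) :
    (unif (ι × Φ × δ → G)).real {h | ¬ UniqueOutputs K (tabSum h)} ≤
      failureBound (Nat.card ι) (Nat.card Φ) (Nat.card δ) (Nat.card G) K := by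
  classical
  have := fun a => Fintype.ofFinite (Witness ι Φ δ 12 a)
  have hsub : {h : ι × Φ × δ → G | ¬ UniqueOutputs K (tabSum h)} ⊆
      ⋃ a ∈ Finset.Icc 2 K, ⋃ W ∈ Finset.univ.filter fun W : Witness ι Φ δ 12 a => W.Valid,
        {h | W.Holds h} := by
    intro h hh
    obtain ⟨a, ha, W, hW, hWh⟩ := exists_witness hd hh
    simp only [Set.mem_iUnion]
    exact ⟨a, ha, W, Finset.mem_filter.mpr ⟨Finset.mem_univ W, hW⟩, hWh⟩
  refine (measureReal_mono hsub (measure_ne_top _ _)).trans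
    ((measureReal_biUnion_finset_le _ _).trans ?_)
  refine Finset.sum_le_sum fun a _ => (measureReal_biUnion_finset_le _ _).trans ?_
  rw [← Witness.natCard_eq, ← mul_one_div, ← nsmul_eq_mul, Nat.card_eq_fintype_card]
  refine (Finset.sum_le_card_nsmul _ _ _ fun W hW => ?_).trans
    (nsmul_le_nsmul_left (by positivity) (Finset.card_le_univ _))
  exact (Finset.mem_filter.mp hW).2.unif_holds_le (by omega)

theorem UniqueOutputs.comp_injective {K L δ Ψ : Type} {k : ℕ} {f : K → δ → Ψ}
    (hf : UniqueOutputs k f) {e : L → K} (he : Function.Injective e) :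
    UniqueOutputs k fun x => f (e x) := by
  intro X hX hcard
  obtain ⟨_, hmem, j, hj⟩ := hf (X.map ⟨e, he⟩) hX.map ((X.card_map _).trans_le hcard)
  obtain ⟨x, hx, rfl⟩ := Finset.mem_map.mp hmem
  exact ⟨x, hx, j, fun y hy hxy => he (hj (e y) (Finset.mem_map_of_mem ⟨e, he⟩ hy) hxy)⟩

theorem natCard_bitVec (t : ℕ) : Nat.card (BitVec t) = 2 ^ t := by
  rw [Nat.card_congr (BitVec.equivFin (m := t)).toEquiv, Nat.card_fin]

theorem unif_not_uniqueOutputs_simpleTab_le {n s d t : ℕ} (K : ℕ) (hd : 11 * n < d) :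
    (unif (Tables n s d t)).real {h | ¬ UniqueOutputs K (simpleTab h)} ≤
      failureBound n (2 ^ s) d (2 ^ t) K := by
  let uncurry : Tables n s d t → Fin n × BitVec s × Fin d → XorVec t :=
    fun h z => h z.1 z.2.1 z.2.2
  have hmap : (unif (Tables n s d t)).map uncurry = unif (Fin n × BitVec s × Fin d → XorVec t) :=
    unif_map_of_surjective (G := Fin n → BitVec s → Fin d → XorVec t)
      (AddMonoidHom.mk' uncurry fun _ _ => rfl) fun T => ⟨fun i α j => T (i, α, j), rfl⟩
  calc (unif (Tables n s d t)).real {h | ¬ UniqueOutputs K (simpleTab h)}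
      ≤ (unif (Tables n s d t)).real (uncurry ⁻¹' {T | ¬ UniqueOutputs K (tabSum T)}) :=
        measureReal_mono (fun h hh hT => hh (hT.comp_injective charAt_injective))
          (measure_ne_top _ _)
    _ = (unif (Fin n × BitVec s × Fin d → XorVec t)).real {T | ¬ UniqueOutputs K (tabSum T)} := by
        rw [← hmap, map_measureReal_apply (measurable_of_finite _) (Set.toFinite _).measurableSet]
    _ ≤ failureBound n (2 ^ s) d (2 ^ t) K := by
        have hle := unif_not_uniqueOutputs_tabSum_le (ι := Fin n) (Φ := BitVec s) (δ := Fin d)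
          (G := XorVec t) K (by simpa using hd)
        have hcard : Nat.card (XorVec t) = 2 ^ t := natCard_bitVec t
        rwa [Nat.card_fin, Nat.card_fin, natCard_bitVec, hcard] at hle

theorem unif_not_forall_uniqueOutputs_le (s ℓ K : ℕ) :
    (unif (UniversalTables s ℓ)).real {h | ¬ ∀ m, UniqueOutputs K (simpleTab (h m))} ≤
      ∑ m : Fin ℓ, failureBound (2 ^ ((m : ℕ) + 1)) (2 ^ s) (12 * 2 ^ ((m : ℕ) + 1))
        (2 ^ (2 ^ (m : ℕ) * s)) K := by
  have hunion : {h : UniversalTables s ℓ | ¬ ∀ m, UniqueOutputs K (simpleTab (h m))} =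
      ⋃ m, Function.eval m ⁻¹' {g | ¬ UniqueOutputs K (simpleTab g)} := by
    ext h
    simp
  rw [hunion]
  refine (measureReal_iUnion_fintype_le _).trans (Finset.sum_le_sum fun m _ => ?_)
  have hprob (m : Fin ℓ) : IsProbabilityMeasure (unif (LevelTables s m)) :=
    isProbabilityMeasure_unif
  have heval := measurePreserving_eval (fun m : Fin ℓ => unif (LevelTables s m)) m
  rw [unif_pi, measureReal_def,
    heval.measure_preimage (Set.toFinite _).measurableSet.nullMeasurableSet, ← measureReal_def]
  have hpos : 0 < 2 ^ ((m : ℕ) + 1) := by positivity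
  exact unif_not_uniqueOutputs_simpleTab_le K (by omega)

/-! ### Reasoning about programs -/

section Hoare

variable {w S : ℕ}

/-- The state after storing the number `a`, reduced modulo `2 ^ w`, in register `i`. -/
def State.set (σ : State w) (i a : ℕ) : State w :=
  { σ with reg := Function.update σ.reg i (BitVec.ofNat w a) }

@[simp]
theorem State.set_reg (σ : State w) (i a j : ℕ) :
    (σ.set i a).reg j = if j = i then BitVec.ofNat w a else σ.reg j :=
  Function.update_apply _ _ _ _

/-- The expression `e` evaluates without error to the number `a`, reduced modulo `2 ^ w`. -/
def EvalsTo (S : ℕ) (σ : State w) (e : Expr) (a : ℕ) : Prop :=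
  e.eval S σ = some (BitVec.ofNat w a)

/-- The program `p` terminates within `T` steps in a state that satisfies `Q`. -/
def Runs (S : ℕ) (p : Cmd) (σ : State w) (T : ℕ) (Q : State w → Prop) : Prop :=
  ∃ t σ', Exec S p σ t σ' ∧ t ≤ T ∧ Q σ'

namespace EvalsTo

variable {σ : State w} {e e₁ e₂ : Expr} {a b : ℕ}

theorem lit (n : ℕ) : EvalsTo S σ (.lit n) n :=
  rfl

theorem reg (i : ℕ) (h : σ.reg i = BitVec.ofNat w a) : EvalsTo S σ (.reg i) a :=
  congrArg some h

theorem load (he : EvalsTo S σ e a) (ha : a < S) (hS : S ≤ 2 ^ w)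
    (hm : σ.mem a = BitVec.ofNat w b) : EvalsTo S σ (.load e) b := by
  rw [EvalsTo] at he ⊢
  simp only [Expr.eval, he, Option.bind_some, BitVec.toNat_ofNat,
    Nat.mod_eq_of_lt (ha.trans_le hS), ha, if_true, hm]

theorem bin {o : Op} {c : ℕ} (h₁ : EvalsTo S σ e₁ a) (h₂ : EvalsTo S σ e₂ b)
    (h : o.eval (BitVec.ofNat w a) (BitVec.ofNat w b) = BitVec.ofNat w c) :
    EvalsTo S σ (.bin o e₁ e₂) c := by
  rw [EvalsTo] at h₁ h₂ ⊢
  simp only [Expr.eval, h₁, h₂, Option.bind_some, h]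

theorem add (h₁ : EvalsTo S σ e₁ a) (h₂ : EvalsTo S σ e₂ b) :
    EvalsTo S σ (.bin .add e₁ e₂) (a + b) :=
  h₁.bin h₂ (BitVec.ofNat_add a b).symm

theorem mul (h₁ : EvalsTo S σ e₁ a) (h₂ : EvalsTo S σ e₂ b) :
    EvalsTo S σ (.bin .mul e₁ e₂) (a * b) :=
  h₁.bin h₂ (BitVec.ofNat_mul a b).symm

theorem sub (h₁ : EvalsTo S σ e₁ a) (h₂ : EvalsTo S σ e₂ b) (hb : b < 2 ^ w) (h : b ≤ a) :
    EvalsTo S σ (.bin .sub e₁ e₂) (a - b) :=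
  h₁.bin h₂ (BitVec.ofNat_sub_ofNat_of_le a b hb h)

theorem div (h₁ : EvalsTo S σ e₁ a) (h₂ : EvalsTo S σ e₂ b) (ha : a < 2 ^ w) (hb : b < 2 ^ w) :
    EvalsTo S σ (.bin .div e₁ e₂) (a / b) :=
  h₁.bin h₂ (by simp [Op.eval, BitVec.udiv_def, Nat.mod_eq_of_lt ha, Nat.mod_eq_of_lt hb])

theorem mod (h₁ : EvalsTo S σ e₁ a) (h₂ : EvalsTo S σ e₂ b) (ha : a < 2 ^ w) (hb : b < 2 ^ w) :
    EvalsTo S σ (.bin .mod e₁ e₂) (a % b) :=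
  h₁.bin h₂ (by simp [Op.eval, BitVec.umod_def, Nat.mod_eq_of_lt ha, Nat.mod_eq_of_lt hb])

theorem xor (h₁ : EvalsTo S σ e₁ a) (h₂ : EvalsTo S σ e₂ b) :
    EvalsTo S σ (.bin .xor e₁ e₂) (a ^^^ b) :=
  h₁.bin h₂ (BitVec.ofNat_xor).symm

theorem shl (h₁ : EvalsTo S σ e₁ a) (h₂ : EvalsTo S σ e₂ b) (hb : b < 2 ^ w) :
    EvalsTo S σ (.bin .shl e₁ e₂) (a * 2 ^ b) :=
  h₁.bin h₂ <| BitVec.eq_of_toNat_eq <| by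
    simp [Op.eval, Nat.shiftLeft_eq, Nat.mod_eq_of_lt hb]

theorem shr (h₁ : EvalsTo S σ e₁ a) (h₂ : EvalsTo S σ e₂ b) (ha : a < 2 ^ w) (hb : b < 2 ^ w) :
    EvalsTo S σ (.bin .shr e₁ e₂) (a / 2 ^ b) :=
  h₁.bin h₂ <| BitVec.eq_of_toNat_eq <| by
    simp [Op.eval, Nat.shiftRight_eq_div_pow, Nat.mod_eq_of_lt ha, Nat.mod_eq_of_lt hb,
      Nat.mod_eq_of_lt ((Nat.div_le_self a _).trans_lt ha)]

theorem lt (h₁ : EvalsTo S σ e₁ a) (h₂ : EvalsTo S σ e₂ b) (ha : a < 2 ^ w) (hb : b < 2 ^ w) :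
    EvalsTo S σ (.bin .lt e₁ e₂) (if a < b then 1 else 0) :=
  h₁.bin h₂ <| by
    simp only [Op.eval, BitVec.lt_def, BitVec.toNat_ofNat, Nat.mod_eq_of_lt ha, Nat.mod_eq_of_lt hb,
      apply_ite (BitVec.ofNat w)]
    rfl

end EvalsTo

namespace Runs

variable {σ : State w} {p q : Cmd} {T T₁ T₂ : ℕ} {Q Q' R : State w → Prop} {e : Expr} {a : ℕ}

theorem mono (h : Runs S p σ T₁ Q) (hT : T₁ ≤ T₂) (hQ : ∀ σ', Q σ' → Q' σ') :
    Runs S p σ T₂ Q' := by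
  obtain ⟨t, σ', hE, ht, hq⟩ := h
  exact ⟨t, σ', hE, ht.trans hT, hQ _ hq⟩

theorem mono_time (h : Runs S p σ T₁ Q) (hT : T₁ ≤ T₂) : Runs S p σ T₂ Q :=
  h.mono hT fun _ hQ => hQ

theorem assign (i : ℕ) (he : EvalsTo S σ e a) (hQ : Q (σ.set i a)) :
    Runs S (.assign i e) σ (e.cost + 1) Q :=
  ⟨_, _, .assign he, le_rfl, hQ⟩

theorem seq (hp : Runs S p σ T₁ R) (hq : ∀ σ', R σ' → Runs S q σ' T₂ Q) :
    Runs S (.seq p q) σ (T₁ + T₂) Q := by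
  obtain ⟨t₁, σ₁, hE₁, ht₁, hR⟩ := hp
  obtain ⟨t₂, σ₂, hE₂, ht₂, hQ⟩ := hq σ₁ hR
  exact ⟨_, _, .seq hE₁ hE₂, by omega, hQ⟩

theorem assign_seq (i : ℕ) (he : EvalsTo S σ e a) (hq : Runs S q (σ.set i a) T Q) :
    Runs S (.seq (.assign i e) q) σ (e.cost + 1 + T) Q :=
  seq (assign (Q := (· = σ.set i a)) i he rfl) fun _ hσ' => hσ' ▸ hq

theorem loop_end (he : EvalsTo S σ e 0) (hQ : Q σ) : Runs S (.loop e p) σ (e.cost + 1) Q :=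
  ⟨_, _, .loop_false he rfl, le_rfl, hQ⟩

theorem loop_step (he : EvalsTo S σ e a) (ha : 0 < a) (haw : a < 2 ^ w)
    (hp : Runs S p σ T₁ R) (hl : ∀ σ', R σ' → Runs S (.loop e p) σ' T₂ Q) :
    Runs S (.loop e p) σ (e.cost + T₁ + T₂ + 1) Q := by
  obtain ⟨t₁, σ₁, hE₁, ht₁, hR⟩ := hp
  obtain ⟨t₂, σ₂, hE₂, ht₂, hQ⟩ := hl σ₁ hR
  refine ⟨_, _, .loop_true he (fun h0 => ha.ne' ?_) hE₁ hE₂, by omega, hQ⟩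
  simpa [Nat.mod_eq_of_lt haw] using congrArg BitVec.toNat h0

theorem loop_count (hw : 1 < 2 ^ w) (I : ℕ → State w → Prop) (n : ℕ)
    (hstep : ∀ k < n, ∀ σ, I k σ → EvalsTo S σ e 1 ∧ Runs S p σ T (I (k + 1)))
    (hend : ∀ σ, I n σ → EvalsTo S σ e 0 ∧ Q σ) (h0 : I 0 σ) :
    Runs S (.loop e p) σ (n * (e.cost + T + 1) + (e.cost + 1)) Q := by
  suffices h : ∀ m k, k + m = n → ∀ σ, I k σ →
      Runs S (.loop e p) σ (m * (e.cost + T + 1) + (e.cost + 1)) Q from h n 0 (by omega) σ h0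
  intro m
  induction m with
  | zero =>
    rintro k rfl σ hI
    exact (loop_end (hend σ hI).1 (hend σ hI).2).mono_time (by omega)
  | succ m ih =>
    intro k hk σ hI
    obtain ⟨he, hp⟩ := hstep k (by omega) σ hI
    refine (loop_step he one_pos hw hp (ih (k + 1) (by omega))).mono_time ?_
    rw [Nat.succ_mul]
    omega

end Runs

end Hoare

/-! ### Recursive tabulation as an exclusive-or over the leaves -/

/-- The number of output positions on the bottom of a recursion of depth `ℓ`. -/
def leafCount : ℕ → ℕ
  | 0 => 1
  | m + 1 => leafCount m * (12 * 2 ^ (m + 1))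

theorem leafCount_pos : ∀ ℓ, 0 < leafCount ℓ
  | 0 => Nat.one_pos
  | m + 1 => Nat.mul_pos (leafCount_pos m) (by positivity)

/-- The output position chosen on level `m + 1` by the leaf with number `q`: the numbers are
read in a mixed radix system whose last digit belongs to the top level. -/
def leafDigit (m q : ℕ) : Fin (12 * 2 ^ (m + 1)) :=
  ⟨q % (12 * 2 ^ (m + 1)), Nat.mod_lt _ (by positivity)⟩

/-- The leaf with number `q`. -/
def leafOf : (ℓ : ℕ) → ℕ → Leaf ℓ
  | 0, _ => ()
  | m + 1, q => (leafDigit m q, leafOf m (q / (12 * 2 ^ (m + 1))))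

/-- The key that arrives at the leaf with number `q`. -/
def leafKey {s : ℕ} : (ℓ : ℕ) → UniversalTables s ℓ → BitVec (2 ^ ℓ * s) → ℕ → BitVec (2 ^ 0 * s)
  | 0, _, x, _ => x
  | m + 1, h, x, q => leafKey m (fun i => h i.castSucc)
      (simpleTab (h (Fin.last m)) x (leafDigit m q)) (q / (12 * 2 ^ (m + 1)))

/-- The entry that the leaf with number `q` contributes to the hash value of `x`. -/
def leafEntry {s b ℓ : ℕ} (h : UniversalTables s ℓ) (r : LeafTables s b ℓ)
    (x : BitVec (2 ^ ℓ * s)) (q : ℕ) : BitVec b :=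
  r (leafOf ℓ q) (charAt (leafKey ℓ h x q) ⟨0, Nat.one_pos⟩)

theorem xorSum_mul {k m b : ℕ} (f : Fin (k * m) → BitVec b) :
    xorSum f = xorSum fun j : Fin m => xorSum fun i : Fin k => f (finProdFinEquiv (i, j)) :=
  (Equiv.sum_comp (M := XorVec b) finProdFinEquiv f).symm.trans
    (Fintype.sum_prod_type_right (γ := XorVec b) fun q : Fin k × Fin m => f (finProdFinEquiv q))

theorem recHash_eq_xorSum {s b : ℕ} : ∀ (ℓ : ℕ) (h : UniversalTables s ℓ)
    (r : LeafTables s b ℓ) (x : BitVec (2 ^ ℓ * s)),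
    recHash ℓ h r x = xorSum fun q : Fin (leafCount ℓ) => leafEntry h r x q
  | 0, h, r, x => (xorSum_eq_single (n := 1) (f := fun q => leafEntry h r x q) 0
      fun i hi => absurd (Subsingleton.elim i 0) hi).symm
  | m + 1, h, r, x => by
    refine Eq.trans (congrArg xorSum (funext fun j => ?_)) (xorSum_mul _).symm
    rw [recHash_eq_xorSum m]
    congr 1 with q
    have hdigit : leafDigit m (finProdFinEquiv (q, j)) = j :=
      Fin.ext (by simp [leafDigit, Nat.mod_eq_of_lt j.isLt])
    have hrest : (finProdFinEquiv (q, j) : ℕ) / (12 * 2 ^ (m + 1)) = q := by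
      rw [finProdFinEquiv_apply_val, Nat.add_mul_div_left _ _ (by positivity),
        Nat.div_eq_of_lt j.isLt, Nat.zero_add]
    simp only [leafEntry, leafOf, leafKey, hdigit, hrest]

/-! ### The representation of the tables in memory -/

/-- The address where the universal tables end and the bottom tables begin. -/
def leafBase (ℓ s : ℕ) : ℕ :=
  7 + (ℓ + 1) * 2 ^ ℓ * 2 ^ s * (12 * 2 ^ ℓ)

/-- The number of memory cells occupied by the header, the universal tables and the bottom
tables. -/
def memSize (ℓ s : ℕ) : ℕ :=
  leafBase ℓ s + leafCount ℓ * 2 ^ s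

/-- The address of output character `j` of the universal tables for the character `ch` in
position `i` of a key of level `lev`. All levels are padded to the dimensions of level `ℓ`, and
the block of level `0` is not used. -/
def univAddr (ℓ s lev i ch j : ℕ) : ℕ :=
  7 + (((lev * 2 ^ ℓ + i) * 2 ^ s + ch) * (12 * 2 ^ ℓ) + j)

/-- The address of the bottom table entry of the leaf with number `q` for the character `ch`. -/
def leafAddr (ℓ s q ch : ℕ) : ℕ :=
  leafBase ℓ s + (q * 2 ^ s + ch)

/-- The parameters that the query program reads from the first seven memory cells. -/
def headerEntry (ℓ s : ℕ) : Fin 7 → ℕ :=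
  ![ℓ, s, leafCount ℓ, 2 ^ ℓ, 2 ^ s, 12 * 2 ^ ℓ, leafBase ℓ s]

/-- The memory `M` starts with the parameters of the recursion. -/
def RepresentsHeader {w : ℕ} (ℓ s : ℕ) (M : ℕ → BitVec w) : Prop :=
  ∀ a : Fin 7, M a = BitVec.ofNat w (headerEntry ℓ s a)

/-- The memory `M` holds the universal tables `T` of level `m + 1`, laid out for a recursion of
depth `ℓ`. -/
def RepresentsLevel {w s m : ℕ} (ℓ : ℕ) (M : ℕ → BitVec w) (T : LevelTables s m) : Prop :=
  ∀ (i : Fin (2 ^ (m + 1))) (ch : BitVec s) (j : Fin (12 * 2 ^ (m + 1))),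
    M (univAddr ℓ s (m + 1) i ch.toNat j) = BitVec.ofNat w (T i ch j).toNat

/-- The memory `M` holds the bottom tables `r`. -/
def RepresentsLeaves {w ℓ s b : ℕ} (M : ℕ → BitVec w) (r : LeafTables s b ℓ) : Prop :=
  ∀ q < leafCount ℓ, ∀ ch, M (leafAddr ℓ s q ch.toNat) = BitVec.ofNat w (r (leafOf ℓ q) ch).toNat

section Layout

variable {ℓ s : ℕ}

theorem mul_add_lt_mul {a b A B : ℕ} (ha : a < A) (hb : b < B) : a * B + b < A * B :=
  calc a * B + b < a * B + B := Nat.add_lt_add_left hb _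
    _ = (a + 1) * B := (Nat.succ_mul a B).symm
    _ ≤ A * B := Nat.mul_le_mul_right _ ha

theorem univAddr_lt_leafBase {lev i ch j : ℕ} (hlev : lev ≤ ℓ) (hi : i < 2 ^ ℓ)
    (hch : ch < 2 ^ s) (hj : j < 12 * 2 ^ ℓ) : univAddr ℓ s lev i ch j < leafBase ℓ s :=
  Nat.add_lt_add_left
    (mul_add_lt_mul (mul_add_lt_mul (mul_add_lt_mul (Nat.lt_succ_of_le hlev) hi) hch) hj) 7

theorem leafBase_le_memSize : leafBase ℓ s ≤ memSize ℓ s :=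
  Nat.le_add_right _ _

theorem leafAddr_lt_memSize {q ch : ℕ} (hq : q < leafCount ℓ) (hch : ch < 2 ^ s) :
    leafAddr ℓ s q ch < memSize ℓ s :=
  Nat.add_lt_add_left (mul_add_lt_mul hq hch) _

theorem lt_memSize {a : ℕ} (ha : a ≤ 12 * 2 ^ ℓ * 2 ^ s) : a < memSize ℓ s :=
  calc a < 7 + 1 * (12 * 2 ^ ℓ * 2 ^ s) := by omega
    _ ≤ 7 + (ℓ + 1) * 2 ^ ℓ * (12 * 2 ^ ℓ * 2 ^ s) := by
      gcongr
      exact Nat.mul_pos ℓ.succ_pos (Nat.two_pow_pos ℓ)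
    _ = leafBase ℓ s := by rw [leafBase]; ring
    _ ≤ memSize ℓ s := leafBase_le_memSize

theorem seven_le_memSize : 7 ≤ memSize ℓ s :=
  (Nat.le_add_right _ _).trans leafBase_le_memSize

theorem leafCount_lt_memSize : leafCount ℓ < memSize ℓ s :=
  (Nat.le_mul_of_pos_right _ (Nat.two_pow_pos s)).trans_lt
    (Nat.lt_add_of_pos_left (Nat.add_pos_left (by norm_num) _))

end Layout

/-- The universal table entry with the given indices, which is `0` in the padding of the
layout. -/
def univEntry {s ℓ : ℕ} (w : ℕ) (h : UniversalTables s ℓ) : (lev i ch j : ℕ) → BitVec w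
  | 0, _, _, _ => 0#w
  | m + 1, i, ch, j =>
    if hm : m < ℓ ∧ i < 2 ^ (m + 1) ∧ j < 12 * 2 ^ (m + 1) then
      BitVec.ofNat w (h ⟨m, hm.1⟩ ⟨i, hm.2.1⟩ (BitVec.ofNat s ch) ⟨j, hm.2.2⟩).toNat
    else 0#w

/-- The memory contents that represent the tables `h` and `r`, obtained by inverting `univAddr`
and `leafAddr`. -/
def tableRep {s b ℓ : ℕ} (w : ℕ) (h : UniversalTables s ℓ) (r : LeafTables s b ℓ) (a : ℕ) :
    BitVec w :=
  if ha : a < 7 then BitVec.ofNat w (headerEntry ℓ s ⟨a, ha⟩)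
  else if a < leafBase ℓ s then
    let row := (a - 7) / (12 * 2 ^ ℓ)
    univEntry w h (row / 2 ^ s / 2 ^ ℓ) (row / 2 ^ s % 2 ^ ℓ) (row % 2 ^ s)
      ((a - 7) % (12 * 2 ^ ℓ))
  else
    let entry := a - leafBase ℓ s
    BitVec.ofNat w (r (leafOf ℓ (entry / 2 ^ s)) (BitVec.ofNat s (entry % 2 ^ s))).toNat

section TableRep

variable {w ℓ s b : ℕ} {h : UniversalTables s ℓ} {r : LeafTables s b ℓ} {M : ℕ → BitVec w}

theorem mul_add_div_of_lt {a b B : ℕ} (hb : b < B) : (a * B + b) / B = a := by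
  rw [Nat.mul_comm, Nat.mul_add_div (Nat.zero_lt_of_lt hb), Nat.div_eq_of_lt hb, Nat.add_zero]

theorem representsHeader_of_eq_tableRep (hM : ∀ a < memSize ℓ s, M a = tableRep w h r a) :
    RepresentsHeader ℓ s M := fun a => by
  rw [hM a (a.isLt.trans_le seven_le_memSize), tableRep, dif_pos a.isLt]

theorem representsLevel_of_eq_tableRep (hM : ∀ a < memSize ℓ s, M a = tableRep w h r a)
    (m : Fin ℓ) : RepresentsLevel ℓ M (h m) := by
  intro i ch j
  have hpow : 2 ^ ((m : ℕ) + 1) ≤ 2 ^ ℓ := Nat.pow_le_pow_right Nat.two_pos m.isLt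
  have hi : (i : ℕ) < 2 ^ ℓ := i.isLt.trans_le hpow
  have hj : (j : ℕ) < 12 * 2 ^ ℓ := j.isLt.trans_le (Nat.mul_le_mul_left _ hpow)
  have hlt := univAddr_lt_leafBase (lev := m + 1) m.isLt hi ch.isLt hj
  have hge : ¬ univAddr ℓ s (m + 1) i ch.toNat j < 7 := not_lt.mpr (Nat.le_add_right _ _)
  rw [hM _ (hlt.trans_le leafBase_le_memSize), tableRep, dif_neg hge, if_pos hlt, univAddr,
    Nat.add_sub_cancel_left]
  simp only [mul_add_div_of_lt hj, mul_add_div_of_lt ch.isLt, mul_add_div_of_lt hi,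
    Nat.mul_add_mod_of_lt hj, Nat.mul_add_mod_of_lt ch.isLt, Nat.mul_add_mod_of_lt hi,
    univEntry, m.isLt, i.isLt, j.isLt, and_self, dif_pos, Fin.eta, BitVec.ofNat_toNat,
    BitVec.setWidth_eq]

theorem representsLeaves_of_eq_tableRep (hM : ∀ a < memSize ℓ s, M a = tableRep w h r a) :
    RepresentsLeaves M r := by
  intro q hq ch
  have h7 : 7 ≤ leafBase ℓ s := Nat.le_add_right _ _
  have hge : leafBase ℓ s ≤ leafAddr ℓ s q ch.toNat := Nat.le_add_right _ _
  rw [hM _ (leafAddr_lt_memSize hq ch.isLt), tableRep, dif_neg (by omega), if_neg (by omega),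
    leafAddr, Nat.add_sub_cancel_left]
  simp only [mul_add_div_of_lt ch.isLt, Nat.mul_add_mod_of_lt ch.isLt, BitVec.ofNat_toNat,
    BitVec.setWidth_eq]

end TableRep

/-! ### The query program -/

/-- The address of the universal table entry for input position `reg 8` of the key `reg 3`. -/
def univAddrExpr : Expr :=
  .bin .add (.lit 7) (.bin .add (.bin .mul (.bin .add (.bin .mul
    (.bin .add (.bin .mul (.reg 5) (.load (.lit 3))) (.reg 8)) (.load (.lit 4)))
    (.bin .mod (.bin .shr (.reg 3) (.bin .mul (.reg 8) (.load (.lit 1)))) (.load (.lit 4))))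
    (.load (.lit 5))) (.reg 6))

/-- Adds the universal table entry for input position `reg 8` to the accumulator `reg 7`. -/
def simpleTabBody : Cmd :=
  .seq (.assign 7 (.bin .xor (.reg 7) (.load univAddrExpr)))
    (.assign 8 (.bin .add (.reg 8) (.lit 1)))

/-- Leaves in `reg 7` output character `reg 6` of the simple tabulation function of level `reg 5`
for the key `reg 3`. -/
def simpleTabProgram : Cmd :=
  .seq (.assign 7 (.lit 0)) (.seq (.assign 8 (.lit 0))
    (.loop (.bin .lt (.reg 8) (.bin .shl (.lit 1) (.reg 5))) simpleTabBody))

/-- One level of `descendLoop`: the output position is the last digit of `reg 4`. -/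
def descendBody : Cmd :=
  .seq (.assign 6 (.bin .mod (.reg 4) (.bin .shl (.lit 12) (.reg 5))))
    (.seq (.assign 4 (.bin .div (.reg 4) (.bin .shl (.lit 12) (.reg 5))))
      (.seq simpleTabProgram
        (.seq (.assign 3 (.reg 7)) (.assign 5 (.bin .sub (.reg 5) (.lit 1))))))

/-- Replaces the key `reg 3` of level `reg 5` by the key that arrives at the leaf with
number `reg 4`. -/
def descendLoop : Cmd :=
  .loop (.reg 5) descendBody

/-- The address of the bottom table entry of leaf `reg 1` for the character `reg 3`. -/
def leafAddrExpr : Expr :=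
  .bin .add (.load (.lit 6)) (.bin .add (.bin .mul (.reg 1) (.load (.lit 4))) (.reg 3))

/-- Adds the bottom table entry of leaf `reg 1` for the key `reg 0` to the accumulator `reg 2`. -/
def leafBody : Cmd :=
  .seq (.assign 3 (.reg 0)) (.seq (.assign 4 (.reg 1)) (.seq (.assign 5 (.load (.lit 0)))
    (.seq descendLoop (.seq (.assign 2 (.bin .xor (.reg 2) (.load leafAddrExpr)))
      (.assign 1 (.bin .add (.reg 1) (.lit 1)))))))

/-- The query program: it visits the leaves one after the other, and so needs no stack. -/
def queryProgram : Cmd :=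
  .seq (.assign 1 (.lit 0)) (.seq (.assign 2 (.lit 0))
    (.seq (.loop (.bin .lt (.reg 1) (.load (.lit 2))) leafBody) (.assign 0 (.reg 2))))

/-- The states `σ` and `σ'` agree on the memory and on the first `n` registers. -/
def State.AgreeBelow {w : ℕ} (n : ℕ) (σ σ' : State w) : Prop :=
  σ'.mem = σ.mem ∧ ∀ i < n, σ'.reg i = σ.reg i

namespace State.AgreeBelow

variable {w n k : ℕ} {σ σ' σ'' : State w}

theorem refl (n : ℕ) (σ : State w) : AgreeBelow n σ σ :=
  ⟨rfl, fun _ _ => rfl⟩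

theorem set (h : AgreeBelow n σ σ') {i : ℕ} (hi : n ≤ i) (a : ℕ) : AgreeBelow n σ (σ'.set i a) :=
  ⟨h.1, fun j hj => (σ'.set_reg i a j).trans ((if_neg (hj.trans_le hi).ne).trans (h.2 j hj))⟩

theorem trans (h : AgreeBelow n σ σ') (h' : AgreeBelow k σ' σ'') (hk : n ≤ k) :
    AgreeBelow n σ σ'' :=
  ⟨h'.1.trans h.1, fun i hi => (h'.2 i (hi.trans_le hk)).trans (h.2 i hi)⟩

end State.AgreeBelow

section Correctness

variable {w ℓ s m : ℕ} {σ : State w}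

theorem RepresentsHeader.evalsTo (hM : RepresentsHeader ℓ s σ.mem) (hS : memSize ℓ s ≤ 2 ^ w)
    (k : Fin 7) : EvalsTo (memSize ℓ s) σ (.load (.lit k)) (headerEntry ℓ s k) :=
  .load (.lit k) (k.isLt.trans_le seven_le_memSize) hS (hM k)

theorem twelve_mul_two_pow_lt (hS : memSize ℓ s ≤ 2 ^ w) : 12 * 2 ^ ℓ < 2 ^ w :=
  (lt_memSize (Nat.le_mul_of_pos_right _ (Nat.two_pow_pos s))).trans_le hS

theorem evalsTo_univAddrExpr (hS : memSize ℓ s ≤ 2 ^ w) (hM : RepresentsHeader ℓ s σ.mem)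
    {x i j : ℕ} (hx : x < 2 ^ w) (hi : i ≤ 2 ^ ℓ) (h3 : σ.reg 3 = BitVec.ofNat w x)
    (h5 : σ.reg 5 = BitVec.ofNat w m) (h6 : σ.reg 6 = BitVec.ofNat w j)
    (h8 : σ.reg 8 = BitVec.ofNat w i) :
    EvalsTo (memSize ℓ s) σ univAddrExpr (univAddr ℓ s m i (x / 2 ^ (i * s) % 2 ^ s) j) := by
  have hshift : i * s < 2 ^ w := by
    refine (lt_memSize (Nat.mul_le_mul ?_ Nat.lt_two_pow_self.le)).trans_le hS
    omega
  have hchars : 2 ^ s < 2 ^ w :=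
    (lt_memSize (Nat.le_mul_of_pos_left _ (by positivity))).trans_le hS
  have hchar : EvalsTo (memSize ℓ s) σ
      (.bin .mod (.bin .shr (.reg 3) (.bin .mul (.reg 8) (.load (.lit 1)))) (.load (.lit 4)))
      (x / 2 ^ (i * s) % 2 ^ s) :=
    .mod (.shr (.reg 3 h3) (.mul (.reg 8 h8) (hM.evalsTo hS 1)) hx hshift) (hM.evalsTo hS 4)
      ((Nat.div_le_self _ _).trans_lt hx) hchars
  exact .add (.lit 7) (.add (.mul (.add (.mul (.add (.mul (.reg 5 h5) (hM.evalsTo hS 3))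
    (.reg 8 h8)) (hM.evalsTo hS 4)) hchar) (hM.evalsTo hS 5)) (.reg 6 h6))

theorem simpleTabBody_runs (hS : memSize ℓ s ≤ 2 ^ w) (hM : RepresentsHeader ℓ s σ.mem)
    (hm : m < ℓ) {T : LevelTables s m} (hT : RepresentsLevel ℓ σ.mem T)
    {x : BitVec (2 ^ (m + 1) * s)} (hx : x.toNat < 2 ^ w) (i : Fin (2 ^ (m + 1)))
    (j : Fin (12 * 2 ^ (m + 1))) {a : BitVec (2 ^ m * s)} (h3 : σ.reg 3 = BitVec.ofNat w x.toNat)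
    (h5 : σ.reg 5 = BitVec.ofNat w (m + 1)) (h6 : σ.reg 6 = BitVec.ofNat w j)
    (h7 : σ.reg 7 = BitVec.ofNat w a.toNat) (h8 : σ.reg 8 = BitVec.ofNat w i) :
    Runs (memSize ℓ s) simpleTabBody σ 40 fun σ' => σ.AgreeBelow 7 σ' ∧
      σ'.reg 7 = BitVec.ofNat w (a ^^^ T i (charAt x i) j).toNat ∧
      σ'.reg 8 = BitVec.ofNat w (i + 1) := by
  have hpow : 2 ^ (m + 1) ≤ 2 ^ ℓ := Nat.pow_le_pow_right Nat.two_pos hm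
  have hi : (i : ℕ) < 2 ^ ℓ := i.isLt.trans_le hpow
  have hj : (j : ℕ) < 12 * 2 ^ ℓ := j.isLt.trans_le (Nat.mul_le_mul_left _ hpow)
  have haddr := evalsTo_univAddrExpr hS hM hx hi.le h3 h5 h6 h8
  rw [← charAt_toNat] at haddr
  have hlt := (univAddr_lt_leafBase hm hi (charAt x i).isLt hj).trans_le leafBase_le_memSize
  refine (Runs.assign_seq 7 (.xor (.reg 7 h7) (.load haddr hlt hS (hT i (charAt x i) j)))
    (Runs.assign 8 (.add (.reg 8 (by simpa using h8)) (.lit 1))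
      ⟨((State.AgreeBelow.refl 7 σ).set le_rfl _).set (by omega) _, ?reg7, ?reg8⟩)).mono_time ?time
  case reg7 => simp
  case reg8 => simp
  case time => simp [Expr.cost, univAddrExpr]

theorem simpleTabProgram_runs (hS : memSize ℓ s ≤ 2 ^ w) (hM : RepresentsHeader ℓ s σ.mem)
    (hm : m < ℓ) {T : LevelTables s m} (hT : RepresentsLevel ℓ σ.mem T)
    {x : BitVec (2 ^ (m + 1) * s)} (hx : x.toNat < 2 ^ w) (j : Fin (12 * 2 ^ (m + 1)))
    (h3 : σ.reg 3 = BitVec.ofNat w x.toNat) (h5 : σ.reg 5 = BitVec.ofNat w (m + 1))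
    (h6 : σ.reg 6 = BitVec.ofNat w j) :
    Runs (memSize ℓ s) simpleTabProgram σ (60 * 2 ^ (m + 1)) fun σ' =>
      σ.AgreeBelow 7 σ' ∧ σ'.reg 7 = BitVec.ofNat w (simpleTab T x j).toNat := by
  have hpow : 2 ^ (m + 1) ≤ 2 ^ ℓ := Nat.pow_le_pow_right Nat.two_pos hm
  have hN : 1 * 2 ^ (m + 1) < 2 ^ w := by linarith [twelve_mul_two_pow_lt hS]
  have hlev : m + 1 < 2 ^ w := by linarith [Nat.lt_two_pow_self (n := m + 1)]
  have hcond {τ : State w} {k : ℕ} (hτ : σ.AgreeBelow 7 τ) (h8 : τ.reg 8 = BitVec.ofNat w k)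
      (hk : k ≤ 2 ^ (m + 1)) :
      EvalsTo (memSize ℓ s) τ (.bin .lt (.reg 8) (.bin .shl (.lit 1) (.reg 5)))
        (if k < 1 * 2 ^ (m + 1) then 1 else 0) :=
    .lt (.reg 8 h8) (.shl (.lit 1) (.reg 5 ((hτ.2 5 (by omega)).trans h5)) hlev)
      (hk.trans_lt (by linarith)) hN
  refine (Runs.assign_seq 7 (.lit 0) <| Runs.assign_seq 8 (.lit 0) <|
    Runs.loop_count (T := 40) (by linarith [Nat.one_le_two_pow (n := m + 1)])
    (fun k τ => σ.AgreeBelow 7 τ ∧ τ.reg 8 = BitVec.ofNat w k ∧ ∃ hk : k ≤ 2 ^ (m + 1),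
      τ.reg 7 = BitVec.ofNat w
        (xorSum fun i : Fin k => T (i.castLE hk) (charAt x (i.castLE hk)) j).toNat)
    (2 ^ (m + 1)) ?step ?exit ?init).mono_time ?time
  case step =>
    rintro k hk τ ⟨hτ, h8, _, h7⟩
    refine ⟨by simpa [hk] using hcond hτ h8 hk.le, ?_⟩
    refine (simpleTabBody_runs (i := ⟨k, hk⟩) hS (hτ.1 ▸ hM) hm (hτ.1 ▸ hT) hx j
      ((hτ.2 3 (by omega)).trans h3) ((hτ.2 5 (by omega)).trans h5)
      ((hτ.2 6 (by omega)).trans h6) h7 h8).mono le_rfl ?_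
    rintro τ' ⟨hτ', h7', h8'⟩
    exact ⟨hτ.trans hτ' le_rfl, h8', hk, h7'.trans (by rw [xorSum_succ]; rfl)⟩
  case exit =>
    rintro τ ⟨hτ, h8, _, h7⟩
    exact ⟨by simpa using hcond hτ h8 le_rfl, hτ, h7⟩
  case init =>
    exact ⟨((State.AgreeBelow.refl 7 σ).set le_rfl _).set (by omega) _, by simp, Nat.zero_le _,
      by simp [xorSum]⟩
  case time =>
    simp only [Expr.cost]
    linarith [Nat.one_le_two_pow (n := m + 1)]

theorem descendBody_runs (hS : memSize ℓ s ≤ 2 ^ w) (hM : RepresentsHeader ℓ s σ.mem)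
    (hm : m < ℓ) {T : LevelTables s m} (hT : RepresentsLevel ℓ σ.mem T)
    {x : BitVec (2 ^ (m + 1) * s)} (hx : x.toNat < 2 ^ w) {q : ℕ} (hq : q < 2 ^ w)
    (h3 : σ.reg 3 = BitVec.ofNat w x.toNat) (h4 : σ.reg 4 = BitVec.ofNat w q)
    (h5 : σ.reg 5 = BitVec.ofNat w (m + 1)) :
    Runs (memSize ℓ s) descendBody σ (70 * 2 ^ (m + 1)) fun σ' => σ.AgreeBelow 3 σ' ∧
      σ'.reg 3 = BitVec.ofNat w (simpleTab T x (leafDigit m q)).toNat ∧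
      σ'.reg 4 = BitVec.ofNat w (q / (12 * 2 ^ (m + 1))) ∧ σ'.reg 5 = BitVec.ofNat w m := by
  have hpow : 2 ^ (m + 1) ≤ 2 ^ ℓ := Nat.pow_le_pow_right Nat.two_pos hm
  have hD : 12 * 2 ^ (m + 1) < 2 ^ w := by linarith [twelve_mul_two_pow_lt hS]
  have hlev : m + 1 < 2 ^ w := by linarith [Nat.lt_two_pow_self (n := m + 1)]
  have hdigits {τ : State w} (hτ : τ.reg 5 = BitVec.ofNat w (m + 1)) :
      EvalsTo (memSize ℓ s) τ (.bin .shl (.lit 12) (.reg 5)) (12 * 2 ^ (m + 1)) :=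
    .shl (.lit 12) (.reg 5 hτ) hlev
  refine (Runs.assign_seq 6 (.mod (.reg 4 h4) (hdigits h5) hq hD) <|
    Runs.assign_seq 4 (.div (.reg 4 (by simpa using h4)) (hdigits (by simpa using h5)) hq hD) <|
    Runs.seq (simpleTabProgram_runs (σ := (σ.set 6 _).set 4 _) hS hM hm hT hx (leafDigit m q)
      (by simpa using h3) (by simpa using h5) (by simp [leafDigit])) fun τ ⟨hτ, h7⟩ =>
    Runs.assign_seq 3 (.reg 7 h7) <| Runs.assign 5
      (.sub (a := m + 1) (.reg 5 ?lev) (.lit 1) (by omega) (by omega))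
      ⟨?agree, by simp, ?quot, by simp⟩).mono_time ?time
  case lev => simpa using (hτ.2 5 (by omega)).trans (by simpa using h5)
  case agree =>
    exact (((((State.AgreeBelow.refl 3 σ).set (by omega) _).set (by omega) _).trans hτ
      (by omega)).set le_rfl _).set (by omega) _
  case quot => simpa using hτ.2 4 (by omega)
  case time =>
    have hN : 1 < 2 ^ (m + 1) := Nat.one_lt_two_pow m.succ_ne_zero
    simp only [Expr.cost]
    omega

theorem descendLoop_runs (hS : memSize ℓ s ≤ 2 ^ w) {M : ℕ → BitVec w}
    (hM : RepresentsHeader ℓ s M) : ∀ {m : ℕ}, m ≤ ℓ → (∀ k < m, 2 ^ k * s ≤ w) →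
    ∀ {h : UniversalTables s m}, (∀ i, RepresentsLevel ℓ M (h i)) →
    ∀ {x : BitVec (2 ^ m * s)}, x.toNat < 2 ^ w → ∀ {q : ℕ}, q < 2 ^ w →
    ∀ {σ : State w}, σ.mem = M → σ.reg 3 = BitVec.ofNat w x.toNat →
      σ.reg 4 = BitVec.ofNat w q → σ.reg 5 = BitVec.ofNat w m →
    Runs (memSize ℓ s) descendLoop σ (m * (75 * 2 ^ ℓ) + 2) fun σ' =>
      σ.AgreeBelow 3 σ' ∧ σ'.reg 3 = BitVec.ofNat w (leafKey m h x q).toNat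
  | 0, _, _, _, _, _, _, _, _, σ, _, h3, _, h5 =>
    (Runs.loop_end (.reg 5 h5) ⟨.refl 3 σ, h3⟩).mono_time (by simp [Expr.cost])
  | m + 1, hm, hkey, h, hT, x, hx, q, hq, σ, hσ, h3, h4, h5 => by
    subst hσ
    have hpow : 2 ^ (m + 1) ≤ 2 ^ ℓ := Nat.pow_le_pow_right Nat.two_pos hm
    have hlev : m + 1 < 2 ^ w := by
      linarith [twelve_mul_two_pow_lt hS, Nat.lt_two_pow_self (n := m + 1)]
    refine (Runs.loop_step (.reg 5 h5) m.succ_pos hlev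
      (descendBody_runs hS hM hm (hT (Fin.last m)) hx hq h3 h4 h5)
      fun τ ⟨hτ, h3', h4', h5'⟩ => (descendLoop_runs hS hM (m.le_succ.trans hm)
        (fun k hk => hkey k (hk.trans m.lt_succ_self)) (fun i => hT i.castSucc) ?fits
        ((Nat.div_le_self _ _).trans_lt hq) hτ.1 h3' h4' h5').mono le_rfl
      fun τ' ⟨hτ', h3''⟩ => ⟨hτ.trans hτ' le_rfl, h3''⟩).mono_time ?time
    case fits =>
      exact (BitVec.isLt _).trans_le (Nat.pow_le_pow_right Nat.two_pos (hkey m m.lt_succ_self))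
    case time =>
      simp only [Expr.cost, add_mul]
      linarith [Nat.one_le_two_pow (n := ℓ)]

theorem evalsTo_leafAddrExpr (hS : memSize ℓ s ≤ 2 ^ w) (hM : RepresentsHeader ℓ s σ.mem)
    {q ch : ℕ} (h1 : σ.reg 1 = BitVec.ofNat w q) (h3 : σ.reg 3 = BitVec.ofNat w ch) :
    EvalsTo (memSize ℓ s) σ leafAddrExpr (leafAddr ℓ s q ch) :=
  .add (hM.evalsTo hS 6) (.add (.mul (.reg 1 h1) (hM.evalsTo hS 4)) (.reg 3 h3))

theorem charAt_zero_toNat (x : BitVec (2 ^ 0 * s)) :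
    (charAt x ⟨0, Nat.one_pos⟩).toNat = x.toNat := by
  have hx : x.toNat < 2 ^ s := by simpa using x.isLt
  simp [charAt_toNat, Nat.mod_eq_of_lt hx]

variable {b : ℕ} {h : UniversalTables s ℓ} {r : LeafTables s b ℓ} {x : BitVec (2 ^ ℓ * s)}

theorem leafBody_runs (hS : memSize ℓ s ≤ 2 ^ w) (hkey : ∀ k < ℓ, 2 ^ k * s ≤ w)
    (hM : RepresentsHeader ℓ s σ.mem) (hT : ∀ i, RepresentsLevel ℓ σ.mem (h i))
    (hr : RepresentsLeaves σ.mem r) (hx : x.toNat < 2 ^ w) {q : ℕ} (hq : q < leafCount ℓ)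
    {a : BitVec b} (h0 : σ.reg 0 = BitVec.ofNat w x.toNat) (h1 : σ.reg 1 = BitVec.ofNat w q)
    (h2 : σ.reg 2 = BitVec.ofNat w a.toNat) :
    Runs (memSize ℓ s) leafBody σ (ℓ * (75 * 2 ^ ℓ) + 30) fun σ' => σ.AgreeBelow 1 σ' ∧
      σ'.reg 1 = BitVec.ofNat w (q + 1) ∧
      σ'.reg 2 = BitVec.ofNat w (a ^^^ leafEntry h r x q).toNat := by
  have hqw : q < 2 ^ w := (hq.trans leafCount_lt_memSize).trans_le hS
  refine (Runs.assign_seq 3 (.reg 0 h0) <| Runs.assign_seq 4 (.reg 1 (by simpa using h1)) <|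
    Runs.assign_seq 5 (RepresentsHeader.evalsTo hM hS 0) <| Runs.seq (T₂ := 17)
    (descendLoop_runs hS hM le_rfl hkey hT hx hqw rfl (by simp) (by simp)
      (by simp [headerEntry])) ?entry).mono_time ?time
  case entry =>
    rintro τ ⟨hτ, h3⟩
    have hστ : σ.AgreeBelow 3 τ := ((((State.AgreeBelow.refl 3 σ).set le_rfl _).set
      (by omega) _).set (by omega) _).trans hτ le_rfl
    have h1' : τ.reg 1 = BitVec.ofNat w q := (hστ.2 1 (by omega)).trans h1
    have h2' : τ.reg 2 = BitVec.ofNat w a.toNat := (hστ.2 2 (by omega)).trans h2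
    rw [← charAt_zero_toNat] at h3
    have hentry := (evalsTo_leafAddrExpr hS (hστ.1 ▸ hM) h1' h3).load
      (leafAddr_lt_memSize hq (BitVec.isLt _)) hS ((congrFun hστ.1 _).trans (hr q hq _))
    refine Runs.assign_seq 2 (.xor (.reg 2 h2') hentry) <| Runs.assign 1
      (.add (.reg 1 (by simpa using h1')) (.lit 1))
      ⟨(((State.AgreeBelow.refl 1 σ).trans hστ (by omega)).set (by omega) _).set le_rfl _,
        by simp, by simp [leafEntry]⟩
  case time =>
    simp only [Expr.cost]
    omega

/-- The number of steps of a query. -/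
def queryTime (ℓ : ℕ) : ℕ :=
  100 * (leafCount ℓ * ((ℓ + 1) * 2 ^ ℓ))

theorem queryProgram_runs (hS : memSize ℓ s ≤ 2 ^ w) (hkey : ∀ k < ℓ, 2 ^ k * s ≤ w)
    (hM : RepresentsHeader ℓ s σ.mem) (hT : ∀ i, RepresentsLevel ℓ σ.mem (h i))
    (hr : RepresentsLeaves σ.mem r) (hx : x.toNat < 2 ^ w)
    (h0 : σ.reg 0 = BitVec.ofNat w x.toNat) :
    Runs (memSize ℓ s) queryProgram σ (queryTime ℓ) fun σ' =>
      σ'.mem = σ.mem ∧ σ'.reg 0 = (recHash ℓ h r x).setWidth w := by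
  have hcount : leafCount ℓ < 2 ^ w := leafCount_lt_memSize.trans_le hS
  have hcond {τ : State w} {k : ℕ} (hτ : σ.AgreeBelow 1 τ) (h1 : τ.reg 1 = BitVec.ofNat w k)
      (hk : k ≤ leafCount ℓ) :
      EvalsTo (memSize ℓ s) τ (.bin .lt (.reg 1) (.load (.lit 2)))
        (if k < leafCount ℓ then 1 else 0) :=
    .lt (.reg 1 h1) (RepresentsHeader.evalsTo (hτ.1 ▸ hM) hS 2) (hk.trans_lt hcount) hcount
  refine (Runs.assign_seq 1 (.lit 0) <| Runs.assign_seq 2 (.lit 0) <|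
    Runs.seq (T₂ := 2) (R := fun τ => τ.mem = σ.mem ∧
      τ.reg 2 = BitVec.ofNat w (recHash ℓ h r x).toNat)
    (Runs.loop_count (T := ℓ * (75 * 2 ^ ℓ) + 30) (by linarith [leafCount_pos ℓ])
    (fun k τ => σ.AgreeBelow 1 τ ∧ τ.reg 1 = BitVec.ofNat w k ∧
      τ.reg 2 = BitVec.ofNat w (xorSum fun i : Fin k => leafEntry h r x i).toNat)
    (leafCount ℓ) ?step ?exit ?init)
    fun τ ⟨hτ, h2⟩ => Runs.assign 0 (.reg 2 h2) ⟨hτ, by simp⟩).mono_time ?time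
  case step =>
    rintro k hk τ ⟨hτ, h1, h2⟩
    refine ⟨by simpa [hk] using hcond hτ h1 hk.le, ?_⟩
    refine (leafBody_runs (h := h) hS hkey (hτ.1 ▸ hM) (hτ.1 ▸ hT) (hτ.1 ▸ hr) hx hk
      ((hτ.2 0 one_pos).trans h0) h1 h2).mono le_rfl ?_
    rintro τ' ⟨hτ', h1', h2'⟩
    exact ⟨hτ.trans hτ' le_rfl, h1', h2'.trans (by rw [xorSum_succ]; rfl)⟩
  case exit =>
    rintro τ ⟨hτ, h1, h2⟩
    exact ⟨by simpa using hcond hτ h1 le_rfl, hτ.1, h2.trans (by rw [recHash_eq_xorSum])⟩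
  case init =>
    exact ⟨((State.AgreeBelow.refl 1 σ).set le_rfl _).set (by omega) _, by simp,
      by simp [xorSum]⟩
  case time =>
    have hD := leafCount_pos ℓ
    have hN : 1 ≤ 2 ^ ℓ := Nat.one_le_two_pow
    simp only [Expr.cost, queryTime]
    nlinarith [Nat.zero_le (ℓ * 2 ^ ℓ), Nat.zero_le (leafCount ℓ * (ℓ * 2 ^ ℓ)),
      Nat.mul_le_mul hD hN, Nat.mul_le_mul_left (leafCount ℓ) hN]

end Correctness

theorem evaluates_tabHash {u c b w : ℕ} (hu : u ≤ 2 ^ w)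
    (hS : memSize (depth c) (charBits u c) ≤ 2 ^ w)
    (hkey : ∀ m < depth c, 2 ^ m * charBits u c ≤ w)
    (h : UniversalTables (charBits u c) (depth c))
    (r : LeafTables (charBits u c) b (depth c)) :
    Evaluates queryProgram w (memSize (depth c) (charBits u c)) (queryTime (depth c))
      (tabHash h r) := by
  refine ⟨_, tableRep w h r, le_rfl, fun x σ hx hσ => ?_⟩
  have hkeyNat : (BitVec.ofNat (2 ^ depth c * charBits u c) x).toNat = x := by
    rw [BitVec.toNat_ofNat, Nat.mod_eq_of_lt (x.isLt.trans_le le_two_pow_keyBits)]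
  obtain ⟨t, σ', hE, ht, hmem, hout⟩ := queryProgram_runs hS hkey
    (representsHeader_of_eq_tableRep hσ) (representsLevel_of_eq_tableRep hσ)
    (representsLeaves_of_eq_tableRep hσ) (hkeyNat.trans_lt (x.isLt.trans_le hu))
    (hx.trans (congrArg _ hkeyNat.symm))
  exact ⟨t, σ', hE, ht, hout, fun a ha => by rw [hmem, hσ a ha]⟩

/-! ### Estimates -/

theorem pow_le_rpow_mul {x y e : ℝ} (hx : 0 ≤ x) (hy : 0 ≤ y) (h : x ≤ y ^ e) (k : ℕ) :
    x ^ k ≤ y ^ (e * k) := by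
  rw [Real.rpow_mul_natCast hy]
  exact pow_le_pow_left₀ hx h k

theorem failureBound_exponent_le {n a s t L : ℝ} (hn : 2 ≤ n) (ha : 2 ≤ a) (hs₀ : 0 ≤ s)
    (ht : 2 * t = n * s) (hs : 24 * (6 + L) ≤ s) :
    L + 2 + s * (n * a) + s / 26 * (n * a) + (6 + L) * (12 * a) + s / 26 * (12 * n * a) ≤
      L + 2 - 5 * s + t * (6 * a) := by
  have hta : t * (6 * a) = 3 * (s * (n * a)) := by linear_combination (3 * a) * ht
  have hLa : (6 + L) * (12 * a) ≤ s * (n * a) / 4 := by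
    have : 0 ≤ s * a * (n - 2) := mul_nonneg (mul_nonneg hs₀ (by linarith)) (by linarith)
    nlinarith
  have hsna : s * 4 ≤ s * (n * a) := mul_le_mul_of_nonneg_left (by nlinarith) hs₀
  linarith

theorem failureBound_term_le {n s t a : ℕ} {L : ℝ} (hn : 2 ≤ n) (ht : 2 * t = n * s)
    (hnL : (n : ℝ) ≤ 2 ^ (L + 2)) (hs : 24 * (6 + L) ≤ s) (ha : 2 ≤ a)
    (has : (a : ℝ) ≤ 2 ^ ((s : ℝ) / 26)) :
    ((n * (2 ^ s) ^ (n * a) * a ^ (n * a) * (12 * n) ^ (12 * a) * a ^ (12 * n * a) : ℕ) : ℝ) /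
      ((2 ^ t : ℕ) : ℝ) ^ (6 * a) ≤ 2 ^ (L + 2 - 5 * s) := by
  have h12 : (12 * n : ℝ) ≤ 2 ^ (6 + L) := by
    have h16 : (2 : ℝ) ^ (6 + L) = 2 ^ 4 * 2 ^ (L + 2) := by
      rw [← Real.rpow_natCast, ← Real.rpow_add two_pos]
      congr 1
      push_cast
      ring
    rw [h16]
    linarith [Nat.cast_nonneg (α := ℝ) n]
  have hden : ((2 ^ t : ℕ) : ℝ) ^ (6 * a) = 2 ^ ((t : ℝ) * (6 * a : ℕ)) := by
    rw [Real.rpow_mul_natCast zero_le_two, Real.rpow_natCast, Nat.cast_pow, Nat.cast_ofNat]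
  rw [hden, div_le_iff₀ (by positivity), ← Real.rpow_add two_pos]
  push_cast
  calc (n : ℝ) * (2 ^ s) ^ (n * a) * a ^ (n * a) * (12 * n) ^ (12 * a) * a ^ (12 * n * a)
      ≤ 2 ^ (L + 2) * 2 ^ ((s : ℝ) * (n * a : ℕ)) * 2 ^ ((s : ℝ) / 26 * (n * a : ℕ)) *
          2 ^ ((6 + L) * (12 * a : ℕ)) * 2 ^ ((s : ℝ) / 26 * (12 * n * a : ℕ)) := by
        have hφ : ((2 : ℝ) ^ s) ≤ 2 ^ (s : ℝ) := (Real.rpow_natCast 2 s).ge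
        gcongr <;> apply pow_le_rpow_mul <;> first | assumption | positivity
    _ = 2 ^ (L + 2 + s * (n * a) + s / 26 * (n * a) + (6 + L) * (12 * a) +
          s / 26 * (12 * n * a)) := by
        push_cast
        simp only [Real.rpow_add two_pos]
    _ ≤ 2 ^ (L + 2 - 5 * s + t * (6 * a)) :=
        Real.rpow_le_rpow_of_exponent_le one_le_two <|
          failureBound_exponent_le (mod_cast hn) (mod_cast ha) (Nat.cast_nonneg s)
            (mod_cast ht) hs

theorem failureBound_le {n s t K : ℕ} {L : ℝ} (hn : 2 ≤ n) (ht : 2 * t = n * s)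
    (hK : (K : ℝ) ≤ 2 ^ ((s : ℝ) / 26)) (hnL : (n : ℝ) ≤ 2 ^ (L + 2))
    (hs : 24 * (6 + L) ≤ s) :
    failureBound n (2 ^ s) (12 * n) (2 ^ t) K ≤ 2 ^ ((s : ℝ) / 26 + (L + 2 - 5 * s)) :=
  calc failureBound n (2 ^ s) (12 * n) (2 ^ t) K
      ≤ ∑ _a ∈ Finset.Icc 2 K, (2 : ℝ) ^ (L + 2 - 5 * s) :=
        Finset.sum_le_sum fun a ha => by
          obtain ⟨ha₂, haK⟩ := Finset.mem_Icc.mp ha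
          exact failureBound_term_le hn ht hnL hs ha₂ ((Nat.cast_le.mpr haK).trans hK)
    _ = ((Finset.Icc 2 K).card : ℝ) * 2 ^ (L + 2 - 5 * s) := by
        rw [Finset.sum_const, nsmul_eq_mul]
    _ ≤ 2 ^ ((s : ℝ) / 26) * 2 ^ (L + 2 - 5 * s) := by
        gcongr
        have hcard : (Finset.Icc 2 K).card ≤ K := by
          rw [Nat.card_Icc]
          omega
        exact (Nat.cast_le.mpr hcard).trans hK
    _ = 2 ^ ((s : ℝ) / 26 + (L + 2 - 5 * s)) := (Real.rpow_add two_pos _ _).symm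

theorem leafCount_le : ∀ ℓ : ℕ, (leafCount ℓ : ℝ) ≤ 2 ^ (((ℓ : ℝ) ^ 2 + 9 * ℓ) / 2)
  | 0 => by simp [leafCount]
  | m + 1 => by
      have h16 : (12 * 2 ^ (m + 1) : ℝ) ≤ 2 ^ ((m : ℝ) + 5) := by
        rw [show (m : ℝ) + 5 = (m + 1 + 4 : ℕ) by push_cast; ring, Real.rpow_natCast,
          pow_add 2 (m + 1) 4]
        linarith [pow_pos (two_pos (α := ℝ)) (m + 1)]
      rw [leafCount]
      push_cast
      calc (leafCount m : ℝ) * (12 * 2 ^ (m + 1))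
          ≤ 2 ^ (((m : ℝ) ^ 2 + 9 * m) / 2) * 2 ^ ((m : ℝ) + 5) := by
            gcongr
            exact leafCount_le m
        _ = 2 ^ ((((m : ℝ) + 1) ^ 2 + 9 * (m + 1)) / 2) := by
            rw [← Real.rpow_add two_pos]
            congr 1
            ring

/-- A common bound for the query time and for the space per element of the input alphabet. -/
def costBound (ℓ : ℕ) : ℕ :=
  2 ^ (8 + 3 * ℓ) * leafCount ℓ

theorem queryTime_le (ℓ : ℕ) : queryTime ℓ ≤ costBound ℓ :=
  calc queryTime ℓ = 100 * ((ℓ + 1) * 2 ^ ℓ) * leafCount ℓ := by rw [queryTime]; ring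
    _ ≤ 2 ^ 8 * (2 ^ ℓ * 2 ^ ℓ * 2 ^ ℓ) * leafCount ℓ := by
        gcongr
        · norm_num
        · exact (Nat.succ_le_of_lt Nat.lt_two_pow_self).trans
            (Nat.le_mul_of_pos_right _ (by positivity))
    _ = costBound ℓ := by rw [costBound]; ring

theorem memSize_le (ℓ s : ℕ) : memSize ℓ s ≤ costBound ℓ * 2 ^ s := by
  have hD : 1 ≤ leafCount ℓ := leafCount_pos ℓ
  have hcube : 1 ≤ 2 ^ (3 * ℓ) := Nat.one_le_two_pow
  have huniv : (ℓ + 1) * 2 ^ ℓ * 2 ^ s * (12 * 2 ^ ℓ) ≤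
      12 * (2 ^ (3 * ℓ) * (leafCount ℓ * 2 ^ s)) :=
    calc (ℓ + 1) * 2 ^ ℓ * 2 ^ s * (12 * 2 ^ ℓ)
        ≤ 2 ^ ℓ * 2 ^ ℓ * (leafCount ℓ * 2 ^ s) * (12 * 2 ^ ℓ) := by
          gcongr
          · exact Nat.lt_two_pow_self
          · exact Nat.le_mul_of_pos_left _ hD
      _ = 12 * (2 ^ (3 * ℓ) * (leafCount ℓ * 2 ^ s)) := by ring
  have hleaf : leafCount ℓ * 2 ^ s ≤ 2 ^ (3 * ℓ) * (leafCount ℓ * 2 ^ s) :=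
    Nat.le_mul_of_pos_left _ hcube
  have hone : 1 ≤ leafCount ℓ * 2 ^ s := Nat.mul_pos hD Nat.one_le_two_pow
  calc memSize ℓ s = 7 + (ℓ + 1) * 2 ^ ℓ * 2 ^ s * (12 * 2 ^ ℓ) + leafCount ℓ * 2 ^ s := rfl
    _ ≤ 2 ^ 8 * (2 ^ (3 * ℓ) * (leafCount ℓ * 2 ^ s)) := by omega
    _ = costBound ℓ * 2 ^ s := by
        rw [costBound]
        ring

theorem costBound_le {ℓ : ℕ} {L : ℝ} (hL : 24 ≤ L) (hℓ : (ℓ : ℝ) ≤ L + 2) :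
    (costBound ℓ : ℝ) ≤ 2 ^ (L ^ 2 - L) :=
  calc (costBound ℓ : ℝ)
      ≤ 2 ^ ((8 + 3 * ℓ : ℕ) : ℝ) * 2 ^ (((ℓ : ℝ) ^ 2 + 9 * ℓ) / 2) := by
        rw [costBound, Real.rpow_natCast]
        push_cast
        gcongr
        exact leafCount_le ℓ
    _ = 2 ^ (8 + 3 * (ℓ : ℝ) + ((ℓ : ℝ) ^ 2 + 9 * ℓ) / 2) := by
        rw [← Real.rpow_add two_pos]
        push_cast
        rfl
    _ ≤ 2 ^ (L ^ 2 - L) := by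
        refine Real.rpow_le_rpow_of_exponent_le one_le_two ?_
        have hsq : (ℓ : ℝ) ^ 2 ≤ (L + 2) ^ 2 := pow_le_pow_left₀ (Nat.cast_nonneg ℓ) hℓ 2
        nlinarith

/-! ### The parameters -/

theorem two_mul_le_two_pow_depth (c : ℕ) : 2 * c ≤ 2 ^ depth c := by
  rw [depth, pow_succ']
  exact Nat.mul_le_mul_left 2 (Nat.le_pow_clog Nat.one_lt_two c)

theorem two_pow_depth_le {c : ℕ} (hc : 2 ≤ c) : 2 ^ depth c ≤ 4 * c := by
  have hclog : Nat.clog 2 c = (Nat.clog 2 c).pred + 1 :=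
    (Nat.succ_pred_eq_of_pos (Nat.clog_pos Nat.one_lt_two hc)).symm
  calc 2 ^ depth c = 4 * 2 ^ (Nat.clog 2 c).pred := by
        rw [depth, hclog, Nat.pred_succ]
        ring
    _ ≤ 4 * c := Nat.mul_le_mul_left 4 (Nat.pow_pred_clog_lt_self Nat.one_lt_two hc).le

theorem two_pow_depth_mul_charBits_le (u c : ℕ) :
    2 ^ depth c * charBits u c ≤ Nat.clog 2 u + 2 ^ depth c := by
  rw [charBits, Nat.ceilDiv_eq_add_pred_div]
  exact (Nat.mul_div_le _ _).trans (Nat.sub_le _ _)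

theorem natCast_clog_le_logb_add_one {b n : ℕ} (hb : 1 < b) (hn : 1 ≤ n) :
    (Nat.clog b n : ℝ) ≤ Real.logb b n + 1 := by
  rw [← Real.natCeil_logb_natCast]
  exact (Nat.ceil_lt_add_one (Real.logb_nonneg (mod_cast hb) (mod_cast hn))).le

/-- The range of parameters for which all estimates hold: `c` is large, and `u` is at least a
large constant power of `c ^ (c ^ 2)`. -/
structure Admissible (u c : ℕ) : Prop where
  le_c : 2 ^ 24 ≤ c
  pow_le_u : c ^ (1000 * c ^ 2) ≤ u

theorem pow_le_of_pow_eq_rpow {c k m u : ℕ} {ε : ℝ} (hc : 1 < c) (hm : m ≠ 0)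
    (hε : k * ε ≤ 1) (h : (c : ℝ) ^ m = (u : ℝ) ^ ε) : c ^ (k * m) ≤ u := by
  have hgt : 1 < (c : ℝ) ^ m := one_lt_pow₀ (mod_cast hc) hm
  have hu : 1 ≤ u := by
    by_contra! hu
    rw [h, Nat.lt_one_iff.mp hu, Nat.cast_zero] at hgt
    exact hgt.not_ge (Real.zero_rpow_le_one ε)
  have hpow : (c : ℝ) ^ (k * m) ≤ u := by
    calc (c : ℝ) ^ (k * m) = (u : ℝ) ^ (ε * k) := by
          rw [mul_comm, pow_mul, h, Real.rpow_mul_natCast (by positivity)]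
      _ ≤ (u : ℝ) ^ (1 : ℝ) := Real.rpow_le_rpow_of_exponent_le (mod_cast hu) (by linarith)
      _ = u := Real.rpow_one _
  exact_mod_cast hpow

namespace Admissible

variable {u c : ℕ}

theorem two_le_c (A : Admissible u c) : 2 ≤ c :=
  (by norm_num : 2 ≤ 2 ^ 24).trans A.le_c

theorem cast_c_pos (A : Admissible u c) : (0 : ℝ) < c :=
  mod_cast two_pos.trans_le A.two_le_c

theorem one_le_u (A : Admissible u c) : 1 ≤ u :=
  (Nat.one_le_pow _ _ (two_pos.trans_le A.two_le_c)).trans A.pow_le_u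

theorem cast_u_pos (A : Admissible u c) : (0 : ℝ) < u :=
  mod_cast A.one_le_u

theorem logb_c_ge (A : Admissible u c) : 24 ≤ Real.logb 2 c := by
  rw [Real.le_logb_iff_rpow_le one_lt_two A.cast_c_pos]
  exact_mod_cast A.le_c

theorem logb_c_le (A : Admissible u c) : Real.logb 2 c ≤ c := by
  rw [Real.logb_le_iff_le_rpow one_lt_two A.cast_c_pos, Real.rpow_natCast]
  exact_mod_cast Nat.lt_two_pow_self.le

theorem mul_logb_c_le (A : Admissible u c) :
    1000 * (c * Real.logb 2 c) ≤ Real.logb 2 u / c := by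
  have hpow : ((c : ℝ) ^ (1000 * c ^ 2)) ≤ u := mod_cast A.pow_le_u
  have hlog := Real.logb_le_logb_of_le one_lt_two (pow_pos A.cast_c_pos _) hpow
  rw [Real.logb_pow] at hlog
  push_cast at hlog
  rw [le_div_iff₀ A.cast_c_pos]
  linarith

theorem c_eq (A : Admissible u c) : (2 : ℝ) ^ Real.logb 2 c = c :=
  Real.rpow_logb two_pos (by norm_num) A.cast_c_pos

theorem one_div_c_eq (A : Admissible u c) : 1 / (c : ℝ) = 2 ^ (-Real.logb 2 c) := by
  rw [Real.rpow_neg zero_le_two, A.c_eq, one_div]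

theorem u_rpow_eq (A : Admissible u c) (z : ℝ) :
    (u : ℝ) ^ (z / (c : ℝ)) = 2 ^ (z * (Real.logb 2 u / c)) := by
  rw [show z * (Real.logb 2 u / c) = Real.logb 2 u * (z / c) by ring, Real.rpow_mul zero_le_two,
    Real.rpow_logb two_pos (by norm_num) A.cast_u_pos]

theorem two_pow_depth_le_rpow (A : Admissible u c) :
    (2 : ℝ) ^ depth c ≤ 2 ^ (Real.logb 2 c + 2) := by
  have h : (2 : ℝ) ^ depth c ≤ 4 * c := mod_cast two_pow_depth_le A.two_le_c
  rw [Real.rpow_add two_pos, A.c_eq, Real.rpow_ofNat]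
  linarith

theorem depth_le (A : Admissible u c) : (depth c : ℝ) ≤ Real.logb 2 c + 2 := by
  rw [← Real.rpow_le_rpow_left_iff one_lt_two, Real.rpow_natCast]
  exact A.two_pow_depth_le_rpow

theorem logb_u_div_le (A : Admissible u c) : Real.logb 2 u / c ≤ 4 * charBits u c := by
  rw [div_le_iff₀ A.cast_c_pos]
  have hlog : Real.logb 2 u ≤ (2 ^ depth c * charBits u c : ℕ) := by
    rw [Real.logb_le_iff_le_rpow one_lt_two A.cast_u_pos, Real.rpow_natCast]
    exact_mod_cast le_two_pow_keyBits
  have hdepth : 2 ^ depth c * charBits u c ≤ 4 * c * charBits u c :=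
    Nat.mul_le_mul_right _ (two_pow_depth_le A.two_le_c)
  calc Real.logb 2 u ≤ (2 ^ depth c * charBits u c : ℕ) := hlog
    _ ≤ (4 * c * charBits u c : ℕ) := mod_cast hdepth
    _ = 4 * charBits u c * c := by
        push_cast
        ring

theorem charBits_le (A : Admissible u c) : (charBits u c : ℝ) ≤ Real.logb 2 u / c / 2 + 2 := by
  have hc := A.cast_c_pos
  have hc₂ : (2 : ℝ) ≤ c := mod_cast A.two_le_c
  have hkey : (2 : ℝ) ^ depth c * charBits u c ≤ Nat.clog 2 u + 2 ^ depth c :=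
    mod_cast two_pow_depth_mul_charBits_le u c
  have hdepth : 2 * (c : ℝ) ≤ 2 ^ depth c := mod_cast two_mul_le_two_pow_depth c
  have hclog : (Nat.clog 2 u : ℝ) ≤ Real.logb 2 u + 1 :=
    mod_cast natCast_clog_le_logb_add_one one_lt_two A.one_le_u
  have hlog : 0 ≤ Real.logb 2 u := Real.logb_nonneg one_lt_two (mod_cast A.one_le_u)
  calc (charBits u c : ℝ) ≤ (Real.logb 2 u + 1 + 2 ^ depth c) / 2 ^ depth c := by
        rw [le_div_iff₀ (by positivity)]
        linarith
    _ = (Real.logb 2 u + 1) / 2 ^ depth c + 1 := by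
        rw [add_div _ ((2 : ℝ) ^ depth c), div_self (by positivity)]
    _ ≤ (Real.logb 2 u + 1) / (2 * c) + 1 := by gcongr
    _ = Real.logb 2 u / c / 2 + (1 / (2 * c) + 1) := by
        field_simp
        ring
    _ ≤ Real.logb 2 u / c / 2 + 2 := by
        have : 1 / (2 * (c : ℝ)) ≤ 1 := (div_le_one (by positivity)).mpr (by linarith)
        linarith

theorem two_pow_depth_le_clog (A : Admissible u c) : 2 ^ depth c ≤ Nat.clog 2 u := by
  have hc := A.two_le_c
  refine (two_pow_depth_le hc).trans ((Nat.pow_le_pow_iff_right Nat.one_lt_two).mp ?_)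
  calc 2 ^ (4 * c) ≤ 2 ^ (1000 * c ^ 2) := Nat.pow_le_pow_right two_pos (by nlinarith)
    _ ≤ c ^ (1000 * c ^ 2) := Nat.pow_le_pow_left hc _
    _ ≤ u := A.pow_le_u
    _ ≤ 2 ^ Nat.clog 2 u := Nat.le_pow_clog Nat.one_lt_two u

theorem two_pow_mul_charBits_le (A : Admissible u c) {w m : ℕ} (hu : u ≤ 2 ^ w)
    (hm : m < depth c) : 2 ^ m * charBits u c ≤ w := by
  have hclog : Nat.clog 2 u ≤ w := Nat.clog_le_of_le_pow hu
  have hkey := two_pow_depth_mul_charBits_le u c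
  have hhalf : 2 * 2 ^ m ≤ 2 ^ depth c := by
    rw [← pow_succ']
    exact Nat.pow_le_pow_right two_pos hm
  have := Nat.mul_le_mul_right (charBits u c) hhalf
  have := A.two_pow_depth_le_clog
  linarith

theorem queryTime_le_rpow (A : Admissible u c) :
    (queryTime (depth c) : ℝ) ≤ 1 / (c : ℝ) * (c : ℝ) ^ Real.logb 2 (c : ℝ) :=
  calc (queryTime (depth c) : ℝ) ≤ costBound (depth c) := mod_cast queryTime_le (depth c)
    _ ≤ 2 ^ (Real.logb 2 c ^ 2 - Real.logb 2 c) := costBound_le A.logb_c_ge A.depth_le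
    _ = 2 ^ (-Real.logb 2 c) * (2 ^ Real.logb 2 c) ^ Real.logb 2 (c : ℝ) := by
        rw [← Real.rpow_mul zero_le_two, ← Real.rpow_add two_pos]
        congr 1
        ring
    _ = 1 / (c : ℝ) * (c : ℝ) ^ Real.logb 2 (c : ℝ) := by rw [A.one_div_c_eq, A.c_eq]

theorem memSize_le_rpow (A : Admissible u c) : (memSize (depth c) (charBits u c) : ℝ) ≤
    1 / (c : ℝ) * (u : ℝ) ^ (1 / (c : ℝ)) :=
  calc (memSize (depth c) (charBits u c) : ℝ)
      ≤ costBound (depth c) * 2 ^ charBits u c := mod_cast memSize_le (depth c) (charBits u c)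
    _ ≤ 2 ^ (Real.logb 2 c ^ 2 - Real.logb 2 c) * 2 ^ (charBits u c : ℝ) := by
        rw [Real.rpow_natCast]
        gcongr
        exact costBound_le A.logb_c_ge A.depth_le
    _ ≤ 2 ^ (-Real.logb 2 c) * 2 ^ (1 * (Real.logb 2 u / c)) := by
        rw [← Real.rpow_add two_pos, ← Real.rpow_add two_pos]
        apply Real.rpow_le_rpow_of_exponent_le one_le_two
        have hsq : Real.logb 2 c ^ 2 ≤ c * Real.logb 2 c := by
          rw [sq]
          exact mul_le_mul_of_nonneg_right A.logb_c_le (by linarith [A.logb_c_ge])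
        nlinarith [A.charBits_le, A.mul_logb_c_le, A.logb_c_ge, A.logb_c_le]
    _ = 1 / (c : ℝ) * (u : ℝ) ^ (1 / (c : ℝ)) := by rw [A.u_rpow_eq, A.one_div_c_eq]

theorem memSize_le_two_pow (A : Admissible u c) {w : ℕ} (hu : u ≤ 2 ^ w) :
    memSize (depth c) (charBits u c) ≤ 2 ^ w := by
  have hc : 1 / (c : ℝ) ≤ 1 := (div_le_one A.cast_c_pos).mpr (mod_cast A.two_le_c.trans' one_le_two)
  have hle : (memSize (depth c) (charBits u c) : ℝ) ≤ u :=
    calc (memSize (depth c) (charBits u c) : ℝ) ≤ 1 / (c : ℝ) * (u : ℝ) ^ (1 / (c : ℝ)) :=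
          A.memSize_le_rpow
      _ ≤ 1 * (u : ℝ) ^ (1 : ℝ) := by
          gcongr
          exact mod_cast A.one_le_u
      _ = u := by rw [Real.rpow_one, one_mul]
  exact (Nat.cast_le.mp hle).trans hu

theorem natCast_floor_u_rpow_le (A : Admissible u c) :
    (⌊(u : ℝ) ^ ((1 / 104 : ℝ) / (c : ℝ))⌋₊ : ℝ) ≤ 2 ^ ((charBits u c : ℝ) / 26) := by
  refine (Nat.floor_le (by positivity)).trans ?_
  rw [A.u_rpow_eq]
  exact Real.rpow_le_rpow_of_exponent_le one_le_two (by linarith [A.logb_u_div_le])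

theorem sum_failureBound_le (A : Admissible u c) :
    ∑ m : Fin (depth c), failureBound (2 ^ ((m : ℕ) + 1)) (2 ^ charBits u c)
        (12 * 2 ^ ((m : ℕ) + 1)) (2 ^ (2 ^ (m : ℕ) * charBits u c))
        ⌊(u : ℝ) ^ ((1 / 104 : ℝ) / (c : ℝ))⌋₊ ≤
      1 / (c : ℝ) * (1 / (u : ℝ) ^ (1 / (c : ℝ))) := by
  set L := Real.logb 2 (c : ℝ)
  set s := charBits u c
  have hL : 24 ≤ L := A.logb_c_ge
  have hsL : 500 * L ≤ s := by
    have hc₂ : (2 : ℝ) ≤ c := mod_cast A.two_le_c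
    nlinarith [A.mul_logb_c_le.trans A.logb_u_div_le]
  have hlevel (m : Fin (depth c)) : ((2 ^ ((m : ℕ) + 1) : ℕ) : ℝ) ≤ 2 ^ (L + 2) := by
    push_cast
    exact (pow_le_pow_right₀ one_le_two m.isLt).trans A.two_pow_depth_le_rpow
  have hdepth : (depth c : ℝ) ≤ 2 ^ (L + 2) :=
    (mod_cast Nat.lt_two_pow_self.le : (depth c : ℝ) ≤ 2 ^ depth c).trans A.two_pow_depth_le_rpow
  calc _ ≤ ∑ _m : Fin (depth c), (2 : ℝ) ^ ((s : ℝ) / 26 + (L + 2 - 5 * s)) :=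
        Finset.sum_le_sum fun m _ => failureBound_le (Nat.le_self_pow m.val.succ_ne_zero 2)
          (by rw [pow_succ]; ring) A.natCast_floor_u_rpow_le (hlevel m) (by linarith)
    _ = (depth c : ℝ) * 2 ^ ((s : ℝ) / 26 + (L + 2 - 5 * s)) := by
        rw [Finset.sum_const, Finset.card_univ, Fintype.card_fin, nsmul_eq_mul]
    _ ≤ 2 ^ (L + 2) * 2 ^ ((s : ℝ) / 26 + (L + 2 - 5 * s)) := by gcongr
    _ ≤ 2 ^ (-L) * 2 ^ (-(1 * (Real.logb 2 u / c))) := by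
        rw [← Real.rpow_add two_pos, ← Real.rpow_add two_pos]
        exact Real.rpow_le_rpow_of_exponent_le one_le_two (by linarith [A.logb_u_div_le])
    _ = 1 / (c : ℝ) * (1 / (u : ℝ) ^ (1 / (c : ℝ))) := by
        rw [A.u_rpow_eq, A.one_div_c_eq, Real.rpow_neg zero_le_two (1 * _),
          one_div ((2 : ℝ) ^ _)]

theorem unif_real_not_good_le (A : Admissible u c) (b : ℕ) :
    (unif (UniversalTables (charBits u c) (depth c))).real
      {h | ¬ ∀ k : ℕ, (k : ℝ) ≤ (u : ℝ) ^ ((1 / 104 : ℝ) / (c : ℝ)) → Good b k h} ≤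
      1 / (c : ℝ) * (1 / (u : ℝ) ^ (1 / (c : ℝ))) := by
  set K := ⌊(u : ℝ) ^ ((1 / 104 : ℝ) / (c : ℝ))⌋₊
  have hK : 1 ≤ K :=
    (Nat.one_le_floor_iff _).mpr (Real.one_le_rpow (mod_cast A.one_le_u) (by positivity))
  have : IsProbabilityMeasure (unif (UniversalTables (charBits u c) (depth c))) :=
    isProbabilityMeasure_unif
  calc (unif (UniversalTables (charBits u c) (depth c))).real
        {h | ¬ ∀ k : ℕ, (k : ℝ) ≤ (u : ℝ) ^ ((1 / 104 : ℝ) / (c : ℝ)) → Good b k h}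
      ≤ (unif (UniversalTables (charBits u c) (depth c))).real
          {h | ¬ ∀ m, UniqueOutputs K (simpleTab (h m))} :=
        measureReal_mono
          (fun h hh hU => hh fun k hk => good_of_uniqueOutputs (Nat.le_floor hk) hK h hU)
          (measure_ne_top _ _)
    _ ≤ ∑ m : Fin (depth c), failureBound (2 ^ ((m : ℕ) + 1)) (2 ^ charBits u c)
          (12 * 2 ^ ((m : ℕ) + 1)) (2 ^ (2 ^ (m : ℕ) * charBits u c)) K :=
        unif_not_forall_uniqueOutputs_le _ _ K
    _ ≤ 1 / (c : ℝ) * (1 / (u : ℝ) ^ (1 / (c : ℝ))) := A.sum_failureBound_le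

end Admissible

theorem isLittleO_of_le_mul {ι : Type*} {l : Filter ι} {f g δ : ι → ℝ}
    (hδ : Tendsto δ l (𝓝 0)) (h : ∀ᶠ n in l, 0 ≤ f n ∧ f n ≤ δ n * g n) : f =o[l] g := by
  have hδg : (fun n => δ n * g n) =o[l] g := by
    simpa using ((isLittleO_one_iff ℝ).mpr hδ).mul_isBigO (isBigO_refl g l)
  refine IsBigO.trans_isLittleO (IsBigO.of_bound 1 ?_) hδg
  filter_upwards [h] with n ⟨hf₀, hf⟩
  rw [Real.norm_of_nonneg hf₀, one_mul]
  exact hf.trans (le_abs_self _)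

theorem eventually_pow_mul_le {ι : Type*} {l : Filter ι} {u c m : ι → ℕ} {ε : ι → ℝ} (k : ℕ)
    (hc : ∀ᶠ n in l, 1 < c n) (hm : ∀ᶠ n in l, m n ≠ 0) (hε : Tendsto ε l (𝓝 0))
    (h : ∀ᶠ n in l, (c n : ℝ) ^ m n = (u n : ℝ) ^ ε n) : ∀ᶠ n in l, c n ^ (k * m n) ≤ u n := by
  have hkε : Tendsto (fun n => k * ε n) l (𝓝 0) := by simpa using hε.const_mul (k : ℝ)
  filter_upwards [hc, hm, h, hkε.eventually_le_const one_pos] with n hcn hmn hn hεn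
  exact pow_le_of_pow_eq_rpow hcn hmn hεn hn

/-- The exponent `o(1)` in `c ^ (c ^ 2) = u ^ o(1)` may be replaced by `1 / 1000`. -/
theorem theorem4_general :
    ∃ (κ : ℝ) (P : Cmd), 0 < κ ∧
      ∀ (ι : Type*) (l : Filter ι) (u c b w : ι → ℕ),
        Tendsto c l atTop →
        (∀ᶠ n in l, c n ^ (1000 * c n ^ 2) ≤ u n) →
        (∀ᶠ n in l, u n ≤ 2 ^ w n ∧ b n ≤ w n) →
        ((fun n => (unif (UniversalTables (charBits (u n) (c n)) (depth (c n)))).real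
            {h | ¬ ∀ k : ℕ, (k : ℝ) ≤ (u n : ℝ) ^ (κ / (c n : ℝ)) → Good (b n) k h})
          =o[l] fun n => 1 / (u n : ℝ) ^ (1 / (c n : ℝ))) ∧
        ∃ S T : ι → ℕ,
          ((fun n => (S n : ℝ)) =o[l] fun n => (u n : ℝ) ^ (1 / (c n : ℝ))) ∧
          ((fun n => (T n : ℝ)) =o[l] fun n => (c n : ℝ) ^ Real.logb 2 (c n : ℝ)) ∧
          ∀ᶠ n in l, ∀ (h : UniversalTables (charBits (u n) (c n)) (depth (c n)))
            (r : LeafTables (charBits (u n) (c n)) (b n) (depth (c n))),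
            Evaluates P (w n) (S n) (T n) (tabHash h r) := by
  refine ⟨1 / 104, queryProgram, by norm_num, fun ι l u c b w hc hu hw => ?_⟩
  have hadm : ∀ᶠ n in l, Admissible (u n) (c n) := by
    filter_upwards [hc.eventually_ge_atTop (2 ^ 24), hu] with n hcn hun
    exact ⟨hcn, hun⟩
  have hδ : Tendsto (fun n => 1 / (c n : ℝ)) l (𝓝 0) :=
    tendsto_one_div_atTop_nhds_zero_nat.comp hc
  refine ⟨isLittleO_of_le_mul hδ ?_, fun n => memSize (depth (c n)) (charBits (u n) (c n)),
    fun n => queryTime (depth (c n)), isLittleO_of_le_mul hδ ?_, isLittleO_of_le_mul hδ ?_, ?_⟩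
  · filter_upwards [hadm] with n hn
    exact ⟨measureReal_nonneg, hn.unif_real_not_good_le (b n)⟩
  · filter_upwards [hadm] with n hn
    exact ⟨Nat.cast_nonneg _, hn.memSize_le_rpow⟩
  · filter_upwards [hadm] with n hn
    exact ⟨Nat.cast_nonneg _, hn.queryTime_le_rpow⟩
  · filter_upwards [hadm, hw] with n hn ⟨huw, _⟩ h r
    exact evaluates_tabHash huw (hn.memSize_le_two_pow huw)
      (fun m hm => hn.two_pow_mul_charBits_le huw hm) h r

end RecTab

theorem theorem4 :
    ∃ (κ : ℝ) (P : Cmd), 0 < κ ∧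
      ∀ (ι : Type) (l : Filter ι) (u c b w : ι → ℕ) (ε : ι → ℝ),
        Tendsto c l atTop →
        -- `c ^ (c ^ 2) = u ^ o(1)`
        Tendsto ε l (𝓝 0) →
        (∀ᶠ n in l, ((c n : ℝ) ^ (c n ^ 2) = (u n : ℝ) ^ ε n)) →
        -- keys and hash values fit in a word
        (∀ᶠ n in l, u n ≤ 2 ^ w n ∧ b n ≤ w n) →
        -- independence `u ^ Ω(1 / c)` with universal probability `1 - o(1 / u ^ (1 / c))`
        ((fun n => (unif (UniversalTables (charBits (u n) (c n)) (depth (c n)))).real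
            {h | ¬ ∀ k : ℕ, (k : ℝ) ≤ (u n : ℝ) ^ (κ / (c n : ℝ)) → Good (b n) k h})
          =o[l] fun n => 1 / (u n : ℝ) ^ (1 / (c n : ℝ))) ∧
        -- space `o(u ^ (1 / c))` and evaluation time `o(c ^ lg c)`
        ∃ S T : ι → ℕ,
          ((fun n => (S n : ℝ)) =o[l] fun n => (u n : ℝ) ^ (1 / (c n : ℝ))) ∧
          ((fun n => (T n : ℝ)) =o[l] fun n => (c n : ℝ) ^ Real.logb 2 (c n : ℝ)) ∧
          ∀ᶠ n in l, ∀ (h : UniversalTables (charBits (u n) (c n)) (depth (c n)))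
            (r : LeafTables (charBits (u n) (c n)) (b n) (depth (c n))),
            Evaluates P (w n) (S n) (T n) (tabHash h r) := by
  obtain ⟨κ, P, hκ, hP⟩ := theorem4_general
  exact ⟨κ, P, hκ, fun ι l u c b w ε hc hε heq => hP ι l u c b w hc <|
    eventually_pow_mul_le 1000 (hc.eventually_gt_atTop 1)
      ((hc.eventually_gt_atTop 1).mono fun n hn => by positivity) hε heq⟩
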